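/- Let $n\ge 2$ be an integer and let $p,l,\alpha,\gamma$ be real numbers with $$1<p<\infty,\quad 0<l<p,\quad 0<\alpha<p,\quad n>\alpha\Bigl(1-\tfrac1p\Bigr)+1,\quad \gamma>-1 .$$ Let $B=B(0,1)\subset\mathbb R^n$ be the open unit ball, $\Phi_p(v)=|v|^{p-2}v$ for $v\in\mathbb R^n\setminus\{0\}$, $\Phi_p(0)=0$, and $\Delta_p w=\operatorname{div}\Phi_p(\nabla w)$. Consider the equation $$-|x|^\alpha\Delta_p w+h(|x|,w,|\nabla w|)=\phi(w)\quad\text{in }\mathcal D'(B), \tag{1}$$ under the following assumptions. (i) $\phi:\mathbb R\to\mathbb R$ is continuous and odd, and $\tau\phi(\tau)>0$ for almost every $\tau$. (ii) $h=h(\tau,\lambda_0,\lambda_1):(0,1)\times\mathbb R\times[0,\infty)\to\mathbb R$ is a Carathéodory function (measurable in $\tau$, and continuous in $(\lambda_0,\lambda_1)$ for almost every $\tau$), and for some constant $C>0$, for all $\lambda_0\in\mathbb R$ and $\lambda_1>0$ and almost every $\tau\in(0,1)$, $$|h(\tau,\lambda_0,\lambda_1)|\le C\,\tau^\gamma|\lambda_0|^l\lambda_1^{p-l-1}.$$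 By a regular radial solution we mean a radial function $w\in C^1(B)$ with $w(0)=0$ and $\Phi_p(\nabla w)\in W^{1,1}_{loc}(B,|x|^{-(n-1)}dx)$ (that is, $\Phi_p(\nabla w)$ and its weak derivative on $B$ are locally integrable on $B$ with respect to $dx$ and to $|x|^{-(n-1)}dx$) that satisfies (1); here $\Delta_p w$ is a locally integrable function, and (1) means that $h(|x|,w,|\nabla w|)$ is locally integrable on $B$ and that both sides agree when tested against every $\eta\in C_c^\infty(B)$. (a) If $\gamma>\alpha-1-l$, then for all $\phi$, $C$, $h$ as in (i) and (ii) there is no regular radial solution $w$ with $w\not\equiv 0$ on $B$. (b) The condition $\gamma>\alpha-1-l$ is sharp: for all $n,p,l,\alpha,\gamma$ as above with $\gamma\le\alpha-1-l$, there are $\phi$, $C>0$ and $h$ satisfying (i) and (ii) for which (1) has a nontrivial regular radial solution, namely $w(x)=|x|^s$ for some $s>1$. -/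

import Mathlib

open MeasureTheory Set
open scoped ContDiff Gradient Distributions

namespace RadialPLaplace

noncomputable section

/-- `ℝⁿ` with its Euclidean norm. -/
abbrev Space (n : ℕ) : Type := EuclideanSpace ℝ (Fin n)

/-- The open unit ball `B = B(0,1)` of `ℝⁿ`. -/
def unitBall (n : ℕ) : TopologicalSpace.Opens (Space n) :=
  ⟨Metric.ball 0 1, Metric.isOpen_ball⟩

/-- `Φ_p(v) = |v|^{p-2} v` for `v ≠ 0`, and `Φ_p(0) = 0`. -/
def PhiP {n : ℕ} (p : ℝ) (v : Space n) : Space n := ‖v‖ ^ (p - 2) • v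

/-- The measure `|x|^{-(n-1)} dx` on `ℝⁿ`. -/
def weightedVolume (n : ℕ) : Measure (Space n) :=
  volume.withDensity fun x => ENNReal.ofReal (‖x‖ ^ (-((n : ℝ) - 1)))

/-- `G` is the weak (distributional) derivative on `B` of the vector field `F`: both are locally
integrable on `B` and `∫ (∂_v η) F = - ∫ η (G v)` for every `η ∈ C_c^∞(B)` and direction `v`. -/
def IsWeakDeriv {n : ℕ} (F : Space n → Space n) (G : Space n → Space n →L[ℝ] Space n) : Prop :=
  LocallyIntegrableOn F (unitBall n) ∧
  LocallyIntegrableOn G (unitBall n) ∧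
  ∀ (η : 𝓓(unitBall n, ℝ)) (v : Space n),
    ∫ x, (fderiv ℝ η x v) • F x = - ∫ x, η x • G x v

/-- `F ∈ W^{1,1}_loc(B, |x|^{-(n-1)} dx)`: the field and its weak derivative are locally
integrable on `B` with respect to the weighted measure. -/
def MemWeightedW11Loc {n : ℕ} (F : Space n → Space n) : Prop :=
  ∃ G : Space n → Space n →L[ℝ] Space n, IsWeakDeriv F G ∧
    LocallyIntegrableOn F (unitBall n) (weightedVolume n) ∧
    LocallyIntegrableOn G (unitBall n) (weightedVolume n)

/-- The locally integrable function `g` is the distributional divergence on `B` of the field `F`. -/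
def IsWeakDiv {n : ℕ} (F : Space n → Space n) (g : Space n → ℝ) : Prop :=
  LocallyIntegrableOn F (unitBall n) ∧
  LocallyIntegrableOn g (unitBall n) ∧
  ∀ η : 𝓓(unitBall n, ℝ), ∫ x, inner ℝ (F x) (∇ (η : Space n → ℝ) x) = - ∫ x, g x * η x

/-- `-|x|^α Δ_p w + h(|x|, w, |∇w|) = φ(w)` in `𝓓'(B)`, where `Δ_p w = div Φ_p(∇w)` is a locally
integrable function `g`, so that its product with `|x|^α` is a distribution. -/
def IsSolution {n : ℕ} (p α : ℝ) (h : ℝ → ℝ → ℝ → ℝ) (φ : ℝ → ℝ) (w : Space n → ℝ) : Prop :=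
  ∃ g : Space n → ℝ, IsWeakDiv (fun x => PhiP p (∇ w x)) g ∧
    LocallyIntegrableOn (fun x => h ‖x‖ (w x) ‖∇ w x‖) (unitBall n) ∧
    ∀ η : 𝓓(unitBall n, ℝ),
      ∫ x, (-(‖x‖ ^ α * g x) + h ‖x‖ (w x) ‖∇ w x‖) * η x = ∫ x, φ (w x) * η x

/-- `w` is radial on `B`. -/
def IsRadial {n : ℕ} (w : Space n → ℝ) : Prop :=
  ∃ u : ℝ → ℝ, ∀ x ∈ unitBall n, w x = u ‖x‖

/-- Radial `C¹` solutions on `B` with `w(0) = 0` and `Φ_p(∇w) ∈ W^{1,1}_loc(B, |x|^{-(n-1)} dx)`. -/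
structure IsRegularRadialSolution {n : ℕ} (p α : ℝ) (h : ℝ → ℝ → ℝ → ℝ) (φ : ℝ → ℝ)
    (w : Space n → ℝ) : Prop where
  radial : IsRadial w
  contDiffOn : ContDiffOn ℝ 1 w (unitBall n)
  zero : w 0 = 0
  sobolev : MemWeightedW11Loc (fun x => PhiP p (∇ w x))
  solution : IsSolution p α h φ w

/-- `h(τ, λ₀, λ₁)` is a Carathéodory function on `(0,1) × (ℝ × [0,∞))`: measurable in `τ` and
continuous in `(λ₀, λ₁)`. -/
def IsCaratheodory (h : ℝ → ℝ → ℝ → ℝ) : Prop :=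
  (∀ l₀ l₁ : ℝ, 0 ≤ l₁ →
    AEStronglyMeasurable (fun τ => h τ l₀ l₁) (volume.restrict (Ioo 0 1))) ∧
  ∀ᵐ τ ∂(volume.restrict (Ioo (0 : ℝ) 1)),
    ContinuousOn (fun z : ℝ × ℝ => h τ z.1 z.2) (univ ×ˢ Ici 0)

/-- `|h(τ, λ₀, λ₁)| ≤ C τ^γ |λ₀|^l λ₁^{p-l-1}`. The bound is only imposed for `λ₁ > 0`: for a
Carathéodory function it passes to `λ₁ = 0` by continuity wherever the right-hand side is finite
there, whereas Lean's `0 ^ y = 0` for `y < 0` would add a spurious constraint. -/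
def GrowthBound (p l γ C : ℝ) (h : ℝ → ℝ → ℝ → ℝ) : Prop :=
  ∀ l₀ l₁ : ℝ, 0 < l₁ → ∀ᵐ τ ∂(volume.restrict (Ioo (0 : ℝ) 1)),
    |h τ l₀ l₁| ≤ C * τ ^ γ * |l₀| ^ l * l₁ ^ (p - l - 1)

/-- `φ` is continuous and odd, and `τ φ(τ) > 0` for almost every `τ`. -/
structure IsAdmissibleNonlinearity (φ : ℝ → ℝ) : Prop where
  continuous : Continuous φ
  odd : ∀ t, φ (-t) = -φ t
  pos : ∀ᵐ t : ℝ, 0 < t * φ t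

end

end RadialPLaplace

namespace RadialPLaplace

/-! Part (a) is an energy argument for the profile `w(x) = u(|x|)`, `U = u'`. The flux `Y = r^(n-1)
Φ_p(U)` is absolutely continuous away from `0`, with `Y' = r^(n-1) (h - φ(u)) / r^α` a.e.
(`radial_equation`). For `q = p/(p-1)` one has `r^α |U|^p = r^β |Y|^q` with `β = α - (n-1) q`, and
the condition on `n` says exactly that `β < 0`. So differentiating the weight gives a term of
favourable sign, and the energy `r^α |U|^p / q + ∫_0^u φ` grows at rate at most `h U ≤ C r^γ |u|^l
|U|^(p-l)` (`energy_le`). The potential `∫_0^u φ` is nonnegative and can be dropped at the right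
endpoint.

Suppose `U = 0` on `[0, R₀]`, and let `M = |U(R)|` be the maximum of `|U|` on a slightly longer
interval. Since `u(0) = 0`, `|u(r)| ≤ M r`, and the energy inequality from `R₀` to `R` becomes `R^α
M^p ≤ K M^p (R^Q - R₀^Q)` with `Q = γ + l + 1`. The hypothesis on `γ` is `Q > α`; it rules out `M >
0` for `R` near `R₀`, even when `R₀ = 0`. Vanishing thus propagates over `[0,1)`
(`eq_zero_of_energy_le`).

For (b), `τ < 1` makes the factor `τ^(α-1-l)` admissible. If `(s-1)(p-1) = 3`, the field
`Φ_p(∇|x|^s)` is the polynomial `c |x|^2 x`, and `|x|^α Δ_p w` and `h` are both multiples of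
`|x|^(α+2)`. Constants are chosen so that `h - |x|^α Δ_p w = |x|^(α+2) = φ(w)`, with `φ` an odd
power. -/

/-! ### Weak derivatives and absolute continuity on an interval -/

theorem exists_Ioo_of_isCompact_subset_Ioo {c d : ℝ} (hcd : c < d) {K : Set ℝ}
    (hK : IsCompact K) (hKs : K ⊆ Ioo c d) :
    ∃ a b, c < a ∧ a < b ∧ b < d ∧ K ⊆ Ioo a b := by
  rcases K.eq_empty_or_nonempty with rfl | hne
  · obtain ⟨a, ha, had⟩ := exists_between hcd
    obtain ⟨b, hab, hbd⟩ := exists_between had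
    exact ⟨a, b, ha, hab, hbd, empty_subset _⟩
  · obtain ⟨x, hx, hxm⟩ := hK.exists_isMinOn hne continuousOn_id
    obtain ⟨y, hy, hym⟩ := hK.exists_isMaxOn hne continuousOn_id
    obtain ⟨a, ha, hax⟩ := exists_between (hKs hx).1
    obtain ⟨b, hyb, hb⟩ := exists_between (hKs hy).2
    have hxy : x ≤ y := hxm hy
    exact ⟨a, b, ha, by linarith, hb,
      fun z hz => ⟨hax.trans_le (hxm hz), (show z ≤ y from hym hz).trans_lt hyb⟩⟩

theorem absolutelyContinuousOnInterval_comp {f g : ℝ → ℝ} {a b : ℝ} {S : Set ℝ}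
    {K : NNReal} (hf : LipschitzOnWith K f S) (hg : AbsolutelyContinuousOnInterval g a b)
    (hS : MapsTo g (uIcc a b) S) : AbsolutelyContinuousOnInterval (fun x => f (g x)) a b := by
  rw [absolutelyContinuousOnInterval_iff] at hg ⊢
  intro ε hε
  -- Dividing by `K + 1` rather than `K` covers `K = 0`.
  obtain ⟨δ, hδ, h⟩ := hg (ε / (K + 1)) (by positivity)
  refine ⟨δ, hδ, fun E hE hEδ => ?_⟩
  have h1 := h E hE hEδ
  calc _ ≤ ∑ i ∈ Finset.range E.1, K * dist (g (E.2 i).1) (g (E.2 i).2) :=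
        Finset.sum_le_sum fun i hi =>
          hf.dist_le_mul _ (hS (hE.1 i hi).1) _ (hS (hE.1 i hi).2)
    _ = K * ∑ i ∈ Finset.range E.1, dist (g (E.2 i).1) (g (E.2 i).2) := by rw [Finset.mul_sum]
    _ ≤ K * (ε / (K + 1)) := by gcongr
    _ < (K + 1) * (ε / (K + 1)) := by gcongr; linarith
    _ = ε := by field

theorem integral_eq_intervalIntegral_of_support_subset {f : ℝ → ℝ} {a b : ℝ} (hab : a ≤ b)
    (hf : Function.support f ⊆ Ioo a b) : ∫ x, f x = ∫ x in a..b, f x := by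
  rw [intervalIntegral.integral_of_le hab,
    setIntegral_eq_integral_of_forall_compl_eq_zero]
  intro x hx
  by_contra h
  exact hx (Ioo_subset_Ioc_self (hf h))

/-- A smooth compactly supported function of zero mean is the derivative of a test function. -/
theorem exists_primitive_of_integral_eq_zero {c d : ℝ} (hcd : c < d) {θ : ℝ → ℝ}
    (hθ : ContDiff ℝ ∞ θ) (hθc : HasCompactSupport θ) (hθs : tsupport θ ⊆ Ioo c d)
    (hθi : ∫ x, θ x = 0) :
    ∃ ζ : ℝ → ℝ, ContDiff ℝ ∞ ζ ∧ HasCompactSupport ζ ∧ tsupport ζ ⊆ Ioo c d ∧ deriv ζ = θ := by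
  obtain ⟨a, b, hca, hab, hbd, hs⟩ := exists_Ioo_of_isCompact_subset_Ioo hcd hθc hθs
  have hs' : Function.support θ ⊆ Ioo a b := (subset_tsupport θ).trans hs
  have hz : ∀ x, x ∉ Ioo a b → θ x = 0 := fun x hx => by
    by_contra h
    exact hx (hs' h)
  have hd : ∀ x, HasDerivAt (fun x => ∫ t in a..x, θ t) (θ x) x := fun x =>
    hθ.continuous.integral_hasStrictDerivAt a x |>.hasDerivAt
  have hder : deriv (fun x => ∫ t in a..x, θ t) = θ := funext fun x => (hd x).deriv
  -- To the right of `b` the primitive equals the full integral of `θ`; this is where zero mean is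
  -- needed.
  have hsupp : Function.support (fun x => ∫ t in a..x, θ t) ⊆ Icc a b := by
    intro x hx
    by_contra hn
    apply hx
    rw [mem_Icc, not_and_or, not_le, not_le] at hn
    rcases hn with hn | hn
    · refine intervalIntegral.integral_zero_ae (Filter.Eventually.of_forall fun t ht => hz t ?_)
      rw [uIoc_of_ge hn.le] at ht
      exact fun h => absurd h.1 (not_lt.2 ht.2)
    · change ∫ t in a..x, θ t = 0
      rw [← integral_eq_intervalIntegral_of_support_subset (hab.le.trans hn.le)
        (hs'.trans (Ioo_subset_Ioo_right hn.le)), hθi]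
  have htsupp : tsupport (fun x => ∫ t in a..x, θ t) ⊆ Icc a b :=
    closure_minimal hsupp isClosed_Icc
  refine ⟨_, ?_, HasCompactSupport.of_support_subset_isCompact isCompact_Icc hsupp,
    htsupp.trans (Icc_subset_Ioo hca hbd), hder⟩
  rw [contDiff_infty_iff_deriv, hder]
  exact ⟨fun x => (hd x).differentiableAt, hθ⟩

/-- The lemma of du Bois-Reymond. -/
theorem exists_eqOn_const_of_integral_mul_deriv_eq_zero {c d : ℝ} (hcd : c < d) {D : ℝ → ℝ}
    (hD : ContinuousOn D (Ioo c d))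
    (h : ∀ ζ : ℝ → ℝ, ContDiff ℝ ∞ ζ → HasCompactSupport ζ → tsupport ζ ⊆ Ioo c d →
      ∫ x, D x * deriv ζ x = 0) :
    ∃ m, ∀ x ∈ Ioo c d, D x = m := by
  -- Subtracting `(∫ ψ) ρ` from any test function `ψ` leaves mean zero, so the constant can only be
  -- `∫ D ρ`.
  obtain ⟨ρ, hρ, hρc, hρs, hρi⟩ : ∃ ρ : ℝ → ℝ, ContDiff ℝ ∞ ρ ∧ HasCompactSupport ρ ∧
      tsupport ρ ⊆ Ioo c d ∧ ∫ x, ρ x = 1 := by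
    let f : ContDiffBump ((c + d) / 2) := ⟨(d - c) / 8, (d - c) / 4, by linarith, by linarith⟩
    refine ⟨f.normed volume, f.contDiff_normed, f.hasCompactSupport_normed, ?_, f.integral_normed⟩
    rw [f.tsupport_normed_eq, Real.closedBall_eq_Icc]
    exact Icc_subset_Ioo (by simp only [f]; linarith) (by simp only [f]; linarith)
  have hint : ∀ ψ : ℝ → ℝ, Continuous ψ → HasCompactSupport ψ → tsupport ψ ⊆ Ioo c d →
      Integrable (fun x => D x * ψ x) := by
    intro ψ hψ hψc hψs
    refine Continuous.integrable_of_hasCompactSupport ?_ hψc.mul_left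
    refine continuous_of_tsupport fun x hx => ?_
    have hx' := hψs (tsupport_mul_subset_right hx)
    exact (hD.continuousAt (isOpen_Ioo.mem_nhds hx')).mul hψ.continuousAt
  refine ⟨∫ x, D x * ρ x, ?_⟩
  have hae : ∀ᵐ x, x ∈ Ioo c d → D x - ∫ x, D x * ρ x = 0 := by
    refine isOpen_Ioo.ae_eq_zero_of_integral_contDiff_smul_eq_zero ?_ ?_
    · exact (hD.sub continuousOn_const).locallyIntegrableOn measurableSet_Ioo
    · intro ψ hψ hψc hψs
      have hψi := hψ.continuous.integrable_of_hasCompactSupport (μ := volume) hψc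
      have hρi' := hρ.continuous.integrable_of_hasCompactSupport (μ := volume) hρc
      have hsub : tsupport (fun x => ψ x - (∫ y, ψ y) * ρ x) ⊆ Ioo c d := by
        refine (tsupport_sub _ _).trans (union_subset hψs ?_)
        exact (tsupport_mul_subset_right).trans hρs
      obtain ⟨ζ, hζ, hζc, hζs, hζd⟩ := exists_primitive_of_integral_eq_zero hcd
        (θ := fun x => ψ x - (∫ y, ψ y) * ρ x) (hψ.sub (contDiff_const.mul hρ))
        (hψc.sub hρc.mul_left) hsub
        (by rw [integral_sub hψi (hρi'.const_mul _), integral_const_mul, hρi]; ring)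
      have h0 := h ζ hζ hζc hζs
      rw [hζd] at h0
      have e1 : ∀ x, D x * (ψ x - (∫ y, ψ y) * ρ x) = D x * ψ x - (∫ y, ψ y) * (D x * ρ x) :=
        fun x => by ring
      simp_rw [e1] at h0
      rw [integral_sub (hint ψ hψ.continuous hψc hψs)
        ((hint ρ hρ.continuous hρc hρs).const_mul _), integral_const_mul] at h0
      have e2 : ∀ x, ψ x • (D x - ∫ x, D x * ρ x) = D x * ψ x - (∫ x, D x * ρ x) * ψ x :=
        fun x => by rw [smul_eq_mul]; ring
      simp_rw [e2]
      rw [integral_sub (hint ψ hψ.continuous hψc hψs) (hψi.const_mul _), integral_const_mul]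
      linarith
  have := Measure.eqOn_open_of_ae_eq (μ := (volume : Measure ℝ)) (U := Ioo c d) (f := D)
    (g := fun _ => ∫ x, D x * ρ x) ?_ isOpen_Ioo hD continuousOn_const
  · exact fun x hx => this hx
  · rw [Filter.EventuallyEq, ae_restrict_iff' measurableSet_Ioo]
    filter_upwards [hae] with x hx hxm using sub_eq_zero.1 (hx hxm)

/-- A continuous function with a locally integrable weak derivative is its primitive. -/
theorem sub_eq_intervalIntegral_of_weak_deriv {c d : ℝ} {V k : ℝ → ℝ}
    (hV : ContinuousOn V (Ioo c d)) (hk : ∀ a ∈ Ioo c d, ∀ b ∈ Ioo c d,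
      IntervalIntegrable k volume a b)
    (h : ∀ ζ : ℝ → ℝ, ContDiff ℝ ∞ ζ → HasCompactSupport ζ → tsupport ζ ⊆ Ioo c d →
      ∫ x, V x * deriv ζ x = - ∫ x, k x * ζ x) {a b : ℝ} (ha : a ∈ Ioo c d) (hb : b ∈ Ioo c d) :
    V b - V a = ∫ x in a..b, k x := by
  have hcd : c < d := ha.1.trans ha.2
  have hac : ∀ a' b', c < a' → a' ≤ b' → b' < d →
      AbsolutelyContinuousOnInterval (fun x => ∫ t in a..x, k t) a' b' := by
    intro a' b' h1 h2 h3
    -- The interval is enlarged to contain the base point `a` of the primitive, which may lie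
    -- outside `[a', b']`.
    have ha1 : min a' a ∈ Ioo c d := ⟨lt_min h1 ha.1, (min_le_right _ _).trans_lt ha.2⟩
    have hb1 : max b' a ∈ Ioo c d := ⟨ha.1.trans_le (le_max_right _ _), max_lt h3 ha.2⟩
    have hle : min a' a ≤ max b' a := (min_le_right _ _).trans (le_max_right _ _)
    refine ((hk _ ha1 _ hb1).absolutelyContinuousOnInterval_intervalIntegral
      (c := a) ?_).mono ?_
    · rw [uIcc_of_le hle]
      exact ⟨min_le_right _ _, le_max_right _ _⟩
    · rw [uIcc_of_le hle, uIcc_of_le h2]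
      exact Icc_subset_Icc (min_le_left _ _) (le_max_left _ _)
  have hKc : ContinuousOn (fun x => ∫ t in a..x, k t) (Ioo c d) := by
    intro x hx
    obtain ⟨a', h1, h1'⟩ := exists_between hx.1
    obtain ⟨b', h2, h2'⟩ := exists_between hx.2
    have := (hac a' b' h1 (h1'.trans h2).le h2').continuousOn
    rw [uIcc_of_le (h1'.trans h2).le] at this
    exact (this.continuousAt (Icc_mem_nhds h1' h2)).continuousWithinAt
  -- `V` minus the primitive of `k` annihilates derivatives of test functions, by parts, so it is
  -- constant.
  obtain ⟨m, hm⟩ := exists_eqOn_const_of_integral_mul_deriv_eq_zero hcd (hV.sub hKc) (by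
    intro ζ hζ hζc hζs
    obtain ⟨a', b', h1, h2, h3, hs⟩ := exists_Ioo_of_isCompact_subset_Ioo hcd hζc hζs
    have hs' : Function.support ζ ⊆ Ioo a' b' := (subset_tsupport ζ).trans hs
    have hsd : Function.support (deriv ζ) ⊆ Ioo a' b' := (support_deriv_subset).trans hs
    have hza : ζ a' = 0 := by
      by_contra hne
      exact lt_irrefl _ (hs' hne).1
    have hzb : ζ b' = 0 := by
      by_contra hne
      exact lt_irrefl _ (hs' hne).2
    have hVI : ContinuousOn V (uIcc a' b') := hV.mono (by
      rw [uIcc_of_le h2.le]; exact Icc_subset_Ioo h1 h3)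
    have hKI : ContinuousOn (fun x => ∫ t in a..x, k t) (uIcc a' b') := hKc.mono (by
      rw [uIcc_of_le h2.le]; exact Icc_subset_Ioo h1 h3)
    have hζd : Continuous (deriv ζ) := hζ.continuous_deriv (by simp)
    have hζac : AbsolutelyContinuousOnInterval ζ a' b' :=
      ((hζ.of_le (by simp)).contDiffOn).absolutelyContinuousOnInterval
    have ibp := (hac a' b' h1 h2.le h3).integral_mul_deriv_eq_deriv_mul hζac
    rw [hza, hzb] at ibp
    have hkk : ∫ x in a'..b', deriv (fun x => ∫ t in a..x, k t) x * ζ x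
        = ∫ x in a'..b', k x * ζ x := by
      refine intervalIntegral.integral_congr_ae ?_
      have hI := hk a' ⟨h1, h2.trans h3⟩ b' ⟨h1.trans h2, h3⟩
      filter_upwards [hI.ae_hasDerivAt_integral] with x hx hxm
      have hx1 := hx (uIoc_subset_uIcc hxm) a' (by simp)
      -- Changing the base point from `a` to `a'` only adds a constant near `x`.
      have e : (fun x => ∫ t in a..x, k t) =ᶠ[nhds x]
          fun x => (∫ t in a..a', k t) + ∫ t in a'..x, k t := by
        rw [uIoc_of_le h2.le] at hxm
        filter_upwards [Ioo_mem_nhds (h1.trans hxm.1) (hxm.2.trans_lt h3)] with y hy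
        rw [intervalIntegral.integral_add_adjacent_intervals
          (hk _ ha _ ⟨h1, h2.trans h3⟩) (hk _ ⟨h1, h2.trans h3⟩ _ hy)]
      rw [e.deriv_eq, deriv_const_add, hx1.deriv]
    have h0 := h ζ hζ hζc hζs
    rw [integral_eq_intervalIntegral_of_support_subset h2.le
        (fun x hx => hsd (right_ne_zero_of_mul hx)),
      integral_eq_intervalIntegral_of_support_subset h2.le
        (fun x hx => hs' (right_ne_zero_of_mul hx))] at h0
    rw [integral_eq_intervalIntegral_of_support_subset h2.le
        (fun x hx => hsd (right_ne_zero_of_mul hx))]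
    simp only [Pi.sub_apply, sub_mul]
    have i1 : IntervalIntegrable (fun x => V x * deriv ζ x) volume a' b' :=
      (hVI.mul hζd.continuousOn).intervalIntegrable
    have i2 : IntervalIntegrable (fun x => (∫ t in a..x, k t) * deriv ζ x) volume a' b' :=
      (hKI.mul hζd.continuousOn).intervalIntegrable
    rw [intervalIntegral.integral_sub i1 i2, h0, ibp, hkk]
    ring)
  have h1 := hm a ha
  have h2 := hm b hb
  simp only [Pi.sub_apply, intervalIntegral.integral_same, sub_zero] at h1 h2
  linarith

/-! ### The energy inequality -/

theorem abs_rpow_mul_self {p : ℝ} (hp : 1 < p) (x : ℝ) : |(|x| ^ (p - 2) * x)| = |x| ^ (p - 1) := by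
  rw [abs_mul, abs_of_nonneg (by positivity)]
  rcases eq_or_ne x 0 with rfl | hx
  · rw [abs_zero, mul_zero, Real.zero_rpow (by linarith)]
  · rw [← Real.rpow_add_one (abs_ne_zero.2 hx)]
    ring_nf

theorem abs_signed_rpow_rpow_conj {p : ℝ} (hp : 1 < p) (x : ℝ) :
    |(|x| ^ (p - 2) * x)| ^ (p / (p - 1)) = |x| ^ p := by
  rw [abs_rpow_mul_self hp, ← Real.rpow_mul (abs_nonneg x)]
  congr 1
  have : p - 1 ≠ 0 := by linarith
  field_simp

/-- `Φ_q` inverts `Φ_p` for the conjugate exponent `q`; this recovers `U` from the flux in the chain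
rule for `|Y|^q`. -/
theorem signed_rpow_conj {p : ℝ} (hp : 1 < p) (x : ℝ) :
    |(|x| ^ (p - 2) * x)| ^ (p / (p - 1) - 2) * (|x| ^ (p - 2) * x) = x := by
  rcases eq_or_ne x 0 with rfl | hx
  · simp
  · rw [abs_rpow_mul_self hp, ← Real.rpow_mul (abs_nonneg x), ← mul_assoc,
      ← Real.rpow_add (abs_pos.2 hx)]
    have h1 : p - 1 ≠ 0 := by linarith
    have : (p - 1) * (p / (p - 1) - 2) + (p - 2) = 0 := by
      field_simp
      ring
    rw [this, Real.rpow_zero, one_mul]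

/-- The set where `t φ(t) ≥ 0` is closed and of full measure, hence everything. -/
theorem IsAdmissibleNonlinearity.nonneg {φ : ℝ → ℝ} (hφ : IsAdmissibleNonlinearity φ) {t : ℝ}
    (ht : 0 ≤ t) : 0 ≤ φ t := by
  have h : ∀ t, 0 ≤ t * φ t := by
    have hc : IsClosed {t : ℝ | 0 ≤ t * φ t} :=
      isClosed_le continuous_const (continuous_id.mul hφ.continuous)
    have hd : Dense {t : ℝ | 0 ≤ t * φ t} :=
      Measure.dense_of_ae (hφ.pos.mono fun t ht => ht.le)
    intro t
    have := hd t
    rwa [hc.closure_eq] at this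
  rcases ht.eq_or_lt with rfl | ht
  · have := hφ.odd 0
    rw [neg_zero] at this
    linarith
  · exact nonneg_of_mul_nonneg_right (h t) ht

theorem IsAdmissibleNonlinearity.primitive_nonneg {φ : ℝ → ℝ} (hφ : IsAdmissibleNonlinearity φ)
    (t : ℝ) : 0 ≤ ∫ s in (0)..t, φ s := by
  have h : ∀ t, 0 ≤ t → 0 ≤ ∫ s in (0)..t, φ s := fun t ht =>
    intervalIntegral.integral_nonneg ht fun s hs => hφ.nonneg hs.1
  rcases le_total 0 t with ht | ht
  · exact h t ht
  · have := h (-t) (by linarith)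
    rw [← neg_zero, ← intervalIntegral.integral_comp_neg, neg_zero] at this
    simp_rw [hφ.odd] at this
    rw [intervalIntegral.integral_neg, ← intervalIntegral.integral_symm] at this
    exact this

/-- The energy inequality for radial solutions on an interval away from the origin. -/
theorem energy_le {p α : ℝ} {k : ℕ} (hp : 1 < p) (hkα : α * (1 - 1 / p) < k)
    {u U κ H D φ : ℝ → ℝ} {a b : ℝ} (ha : 0 < a) (hab : a < b)
    (hφ : Continuous φ) (hu : ∀ r ∈ Icc a b, HasDerivAt u (U r) r) (hU : ContinuousOn U (Icc a b))
    (hκ : IntervalIntegrable κ volume a b)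
    (hV : ∀ x ∈ Icc a b, x ^ k * (|U x| ^ (p - 2) * U x) =
      a ^ k * (|U a| ^ (p - 2) * U a) + ∫ r in a..x, κ r)
    (hκH : ∀ᵐ r, r ∈ Icc a b → κ r = r ^ k * ((H r - φ (u r)) / r ^ α))
    (hHD : ∀ᵐ r, r ∈ Icc a b → H r * U r ≤ D r) (hD : ContinuousOn D (Icc a b)) :
    (p - 1) / p * (b ^ α * |U b| ^ p) + ∫ s in (0)..u b, φ s ≤
      (p - 1) / p * (a ^ α * |U a| ^ p) + (∫ s in (0)..u a, φ s) + ∫ r in a..b, D r := by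
  set q := p / (p - 1) with hq
  have hp1 : 0 < p - 1 := by linarith
  have hq1 : 1 < q := by rw [hq, lt_div_iff₀ hp1]; linarith
  have hqp : (p - 1) / p = 1 / q := by rw [hq, one_div_div]
  -- The exponent for which `x^α |U|^p = x^β |Y|^q` when `Y = x^k Φ_p(U)`; `hkα` makes it
  -- nonpositive.
  set β := α - k * q with hβ
  have hβ0 : β ≤ 0 := by
    have h1 : α * (1 - 1 / p) * q = α := by
      rw [hq]
      field_simp
    have := mul_lt_mul_of_pos_right hkα (show 0 < q by linarith)
    rw [h1] at this
    linarith
  obtain ⟨Y, hY⟩ : ∃ Y : ℝ → ℝ, Y = fun x => a ^ k * (|U a| ^ (p - 2) * U a) + ∫ r in a..x, κ r :=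
    ⟨_, rfl⟩
  have hYV : ∀ x ∈ Icc a b, Y x = x ^ k * (|U x| ^ (p - 2) * U x) := fun x hx => by
    rw [hV x hx, hY]
  have hYac : AbsolutelyContinuousOnInterval Y a b := by
    have h1 : AbsolutelyContinuousOnInterval (fun _ : ℝ => a ^ k * (|U a| ^ (p - 2) * U a)) a b :=
      (contDiff_const.contDiffOn (n := 1)).absolutelyContinuousOnInterval
    rw [hY]
    exact h1.add (hκ.absolutelyContinuousOnInterval_intervalIntegral (by simp))
  have hYq : AbsolutelyContinuousOnInterval (fun x => ‖Y x‖ ^ q) a b := by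
    -- Since `q > 1`, `|t|^q` is `C¹`, hence Lipschitz on the bounded range of `Y`.
    obtain ⟨M, hM⟩ := hYac.exists_bound
    obtain ⟨K, hK⟩ := ((contDiff_norm_rpow (E := ℝ) hq1).contDiffOn
      (s := Icc (-M) M)).exists_lipschitzOnWith one_ne_zero (convex_Icc _ _) isCompact_Icc
    have hmaps : MapsTo Y (uIcc a b) (Icc (-M) M) := fun x hx => abs_le.1 (hM x hx)
    exact absolutelyContinuousOnInterval_comp (f := fun t => ‖t‖ ^ q) hK hYac hmaps
  have hw : AbsolutelyContinuousOnInterval (fun r : ℝ => 1 / q * r ^ β) a b := by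
    refine ContDiffOn.absolutelyContinuousOnInterval ?_
    rw [uIcc_of_le hab.le]
    exact contDiffOn_const.mul (contDiffOn_id.rpow_const_of_ne fun x hx =>
      (ha.trans_le hx.1).ne')
  have hE := hw.fun_mul hYq
  have hEv : ∀ x ∈ Icc a b, 1 / q * x ^ β * ‖Y x‖ ^ q = (p - 1) / p * (x ^ α * |U x| ^ p) := by
    intro x hx
    have hx0 : 0 < x := ha.trans_le hx.1
    rw [hYV x hx, Real.norm_eq_abs, abs_mul, Real.mul_rpow (abs_nonneg _) (abs_nonneg _),
      abs_signed_rpow_rpow_conj hp, abs_of_nonneg (by positivity), ← Real.rpow_natCast,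
      ← Real.rpow_mul hx0.le, hqp, mul_assoc, ← mul_assoc (x ^ β), ← Real.rpow_add hx0, hβ]
    ring_nf
  have hder : ∀ᵐ r, r ∈ Icc a b →
      deriv (fun r => 1 / q * r ^ β * ‖Y r‖ ^ q) r ≤ D r - φ (u r) * U r := by
    filter_upwards [hκH, hHD, hκ.ae_hasDerivAt_integral] with r h1 h2 h3 hr
    have hr0 : 0 < r := ha.trans_le hr.1
    have hYr : HasDerivAt Y (κ r) r := by
      have := h3 (by rwa [uIcc_of_le hab.le]) a (by simp)
      rw [hY]
      exact this.const_add _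
    have hd := ((Real.hasDerivAt_rpow_const (p := β) (Or.inl hr0.ne')).const_mul (1 / q)).mul
      ((hasDerivAt_norm_rpow (Y r) hq1).comp r hYr)
    have e1 : deriv (fun r => 1 / q * r ^ β * ‖Y r‖ ^ q) r = _ := hd.deriv
    rw [e1]
    -- The powers of `r` combine to `r^α`, which cancels the denominator in `κ`.
    have e2 : r ^ β * (‖Y r‖ ^ (q - 2) * Y r) * κ r = U r * (H r - φ (u r)) := by
      have e3 : ‖Y r‖ ^ (q - 2) * Y r = r ^ (k * (q - 1)) * U r := by
        rw [hYV r hr, Real.norm_eq_abs, abs_mul, Real.mul_rpow (abs_nonneg _) (abs_nonneg _),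
          abs_of_nonneg (by positivity : 0 ≤ r ^ k)]
        have e4 := signed_rpow_conj hp (U r)
        rw [← hq] at e4
        calc _ = (r ^ k) ^ (q - 2) * r ^ k *
              (|(|U r| ^ (p - 2) * U r)| ^ (q - 2) * (|U r| ^ (p - 2) * U r)) := by ring
          _ = _ := by
            rw [e4, ← Real.rpow_natCast, ← Real.rpow_mul hr0.le, ← Real.rpow_add hr0]
            ring_nf
      have e5 : r ^ β * r ^ (k * (q - 1)) * r ^ (k : ℝ) = r ^ α := by
        rw [← Real.rpow_add hr0, ← Real.rpow_add hr0, hβ]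
        ring_nf
      have e6 : r ^ α ≠ 0 := (Real.rpow_pos_of_pos hr0 _).ne'
      rw [e3, h1 hr, ← Real.rpow_natCast]
      calc _ = r ^ β * r ^ (k * (q - 1)) * r ^ (k : ℝ) * U r * ((H r - φ (u r)) / r ^ α) := by ring
        _ = _ := by
          rw [e5]
          field_simp
    have hq0 : q ≠ 0 := by linarith
    have e7 : 1 / q * r ^ β * (q * ‖Y r‖ ^ (q - 2) * Y r * κ r) = U r * (H r - φ (u r)) := by
      rw [← e2]
      field_simp
    -- The derivative of the weight is discarded thanks to `β ≤ 0`.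
    have e8 : 1 / q * (β * r ^ (β - 1)) * ‖Y r‖ ^ q ≤ 0 := by
      refine mul_nonpos_of_nonpos_of_nonneg ?_ (by positivity)
      refine mul_nonpos_of_nonneg_of_nonpos (by positivity) ?_
      exact mul_nonpos_of_nonpos_of_nonneg hβ0 (by positivity)
    have := h2 hr
    simp only [Function.comp]
    rw [e7]
    linarith
  have huc : ContinuousOn u (Icc a b) := fun r hr => (hu r hr).continuousAt.continuousWithinAt
  have hφU : ContinuousOn (fun r => φ (u r) * U r) (Icc a b) := (hφ.comp_continuousOn huc).mul hU
  have hDi : IntervalIntegrable D volume a b :=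
    ContinuousOn.intervalIntegrable (by rwa [uIcc_of_le hab.le])
  have hφUi : IntervalIntegrable (fun r => φ (u r) * U r) volume a b :=
    ContinuousOn.intervalIntegrable (by rwa [uIcc_of_le hab.le])
  have hsub : ∫ r in a..b, φ (u r) * U r = (∫ s in (0)..u b, φ s) - ∫ s in (0)..u a, φ s := by
    have := intervalIntegral.integral_comp_mul_deriv (a := a) (b := b) (f := u) (f' := U) (g := φ)
      (fun x hx => hu x (by rwa [uIcc_of_le hab.le] at hx)) (by rwa [uIcc_of_le hab.le]) hφ
    simp only [Function.comp] at this
    rw [this, intervalIntegral.integral_interval_sub_left (hφ.intervalIntegrable _ _)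
      (hφ.intervalIntegrable _ _)]
  have hint := hE.integral_deriv_eq_sub
  have hmono : ∫ r in a..b, deriv (fun r => 1 / q * r ^ β * ‖Y r‖ ^ q) r ≤
      ∫ r in a..b, (D r - φ (u r) * U r) := by
    refine intervalIntegral.integral_mono_ae_restrict hab.le hE.intervalIntegrable_deriv
      (hDi.sub hφUi) ?_
    rw [Filter.EventuallyLE, ae_restrict_iff' measurableSet_Icc]
    exact hder
  rw [hint, intervalIntegral.integral_sub hDi hφUi, hsub, hEv a ⟨le_rfl, hab.le⟩,
    hEv b ⟨hab.le, le_rfl⟩] at hmono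
  linarith

/-! ### Propagation of vanishing from the origin -/

/-- At `R₀ > 0` the left side is `0` and the right side positive, so continuity suffices. At `R₀ =
0` the ratio is `K R^(Q-α)`, which tends to `0` only because `Q > α`. -/
theorem exists_gt_forall_mul_rpow_sub_lt {α Q K R₀ : ℝ} (hα : 0 < α) (hQ : α < Q) (hR₀ : 0 ≤ R₀)
    {y : ℝ} (hy : R₀ < y) :
    ∃ R₁, R₀ < R₁ ∧ R₁ < y ∧ ∀ R, R₀ < R → R ≤ R₁ → K * (R ^ Q - R₀ ^ Q) < R ^ α := by
  have hev : ∀ᶠ R in nhdsWithin R₀ (Ioi R₀), K * (R ^ Q - R₀ ^ Q) < R ^ α := by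
    rcases hR₀.eq_or_lt with rfl | h0
    · have hc : ContinuousAt (fun R : ℝ => K * R ^ (Q - α)) 0 :=
        continuousAt_const.mul (Real.continuousAt_rpow_const _ _ (Or.inr (by linarith)))
      have h1 : ∀ᶠ R in nhds (0 : ℝ), K * R ^ (Q - α) < 1 := by
        refine hc.eventually_lt continuousAt_const ?_
        rw [Real.zero_rpow (by linarith)]
        simp
      filter_upwards [nhdsWithin_le_nhds h1, self_mem_nhdsWithin] with R hR hR0
      have hR0' : 0 < R := hR0
      rw [Real.zero_rpow (by linarith), sub_zero]
      have : K * R ^ Q = K * R ^ (Q - α) * R ^ α := by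
        rw [mul_assoc, ← Real.rpow_add hR0']
        ring_nf
      rw [this]
      exact mul_lt_of_lt_one_left (Real.rpow_pos_of_pos hR0' _) hR
    · refine nhdsWithin_le_nhds (ContinuousAt.eventually_lt (f := fun R => K * (R ^ Q - R₀ ^ Q))
        (g := fun R => R ^ α) ?_ ?_ ?_)
      · exact continuousAt_const.mul
          ((Real.continuousAt_rpow_const _ _ (Or.inl h0.ne')).sub continuousAt_const)
      · exact Real.continuousAt_rpow_const _ _ (Or.inl h0.ne')
      · rw [sub_self, mul_zero]
        exact Real.rpow_pos_of_pos h0 _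
  obtain ⟨z, hz, hzs⟩ := (mem_nhdsGT_iff_exists_Ioo_subset).1 hev
  obtain ⟨R₁, h1, h2⟩ := exists_between (lt_min hz hy)
  exact ⟨R₁, h1, h2.trans_le (min_le_right _ _),
    fun R hR hRR => hzs ⟨hR, hRR.trans_lt (h2.trans_le (min_le_left _ _))⟩⟩

/-- The energy inequality forces a function vanishing at the origin to vanish identically. -/
theorem eq_zero_of_energy_le {p l α γ A : ℝ} (hl : 0 < l) (hlp : l < p) (hα : 0 < α) (hγ : -1 < γ)
    (hγα : α - 1 - l < γ) (hA : 0 ≤ A) {u U Ψ : ℝ → ℝ}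
    (hu : ∀ r ∈ Ico (0 : ℝ) 1, HasDerivAt u (U r) r)
    (hU : ContinuousOn U (Ico 0 1)) (hu0 : u 0 = 0) (hU0 : U 0 = 0) (hΨ : Continuous Ψ)
    (hΨ0 : Ψ 0 = 0)
    (hE : ∀ a b, 0 < a → a < b → b < 1 → b ^ α * |U b| ^ p ≤
      a ^ α * |U a| ^ p + Ψ (u a) + ∫ r in a..b, A * r ^ γ * |u r| ^ l * |U r| ^ (p - l)) :
    ∀ r ∈ Ico (0 : ℝ) 1, u r = 0 := by
  set Q := γ + l + 1 with hQ
  have hp : 0 < p := hl.trans hlp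
  have huc : ContinuousOn u (Ico 0 1) := fun r hr => (hu r hr).continuousAt.continuousWithinAt
  have hmvt : ∀ {R M : ℝ}, R < 1 → (∀ t ∈ Icc 0 R, |U t| ≤ M) → ∀ t ∈ Icc 0 R, |u t| ≤ M * t := by
    intro R M hR hM t ht
    have := (convex_Icc 0 t).norm_image_sub_le_of_norm_hasDerivWithin_le (f := u) (f' := U) (C := M)
      (x := 0) (y := t) ?_ ?_ ⟨le_rfl, ht.1⟩ ⟨ht.1, le_rfl⟩
    · rw [hu0, sub_zero, sub_zero, Real.norm_eq_abs, Real.norm_eq_abs, abs_of_nonneg ht.1] at this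
      exact this
    · exact fun x hx => (hu x ⟨hx.1, (hx.2.trans ht.2).trans_lt hR⟩).hasDerivWithinAt
    · exact fun x hx => hM x ⟨hx.1, hx.2.trans ht.2⟩
  have hstep : ∀ R₀ ∈ Ico (0 : ℝ) 1, (∀ t ∈ Icc 0 R₀, U t = 0) → ∀ y, R₀ < y →
      ∃ R₁, R₀ < R₁ ∧ R₁ < y ∧ ∀ t ∈ Icc 0 R₁, U t = 0 := by
    intro R₀ hR₀ hz y hy
    obtain ⟨R₁, h1, h2, h3⟩ := exists_gt_forall_mul_rpow_sub_lt (K := A / Q) hα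
      (by linarith : α < Q) hR₀.1 (lt_min hy hR₀.2)
    have hR₁ : R₁ < 1 := h2.trans_le (min_le_right _ _)
    refine ⟨R₁, h1, h2.trans_le (min_le_left _ _), ?_⟩
    -- As `U` vanishes on `[0, R₀]`, a maximiser on `[R₀, R₁]` bounds `|U|` on all of `[0, R₁]`.
    obtain ⟨R, hR, hmax⟩ := isCompact_Icc.exists_isMaxOn (nonempty_Icc.2 h1.le)
      ((hU.mono (show Icc R₀ R₁ ⊆ Ico 0 1 from
        fun x hx => ⟨hR₀.1.trans hx.1, hx.2.trans_lt hR₁⟩)).abs)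
    have hM : ∀ t ∈ Icc 0 R₁, |U t| ≤ |U R| := by
      intro t ht
      rcases le_total t R₀ with h | h
      · rw [hz t ⟨ht.1, h⟩, abs_zero]
        exact abs_nonneg _
      · exact hmax ⟨h, ht.2⟩
    suffices |U R| = 0 from fun t ht => abs_eq_zero.1 (le_antisymm (this ▸ hM t ht) (abs_nonneg _))
    by_contra hne
    have hMpos : 0 < |U R| := lt_of_le_of_ne (abs_nonneg _) (Ne.symm hne)
    have hRR : R₀ < R := by
      rcases hR.1.eq_or_lt with h | h
      · exact absurd (by rw [← h, hz R₀ ⟨hR₀.1, le_rfl⟩, abs_zero]) hne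
      · exact h
    have hbound : ∀ a ∈ Ioo R₀ R, R ^ α * |U R| ^ p ≤
        a ^ α * |U a| ^ p + Ψ (u a) + A * |U R| ^ p * ((R ^ Q - a ^ Q) / Q) := by
      intro a ha
      have ha0 : 0 < a := hR₀.1.trans_lt ha.1
      refine (hE a R ha0 ha.2 (hR.2.trans_lt hR₁)).trans ?_
      gcongr
      have hsub : uIcc a R ⊆ Ico 0 1 := by
        rw [uIcc_of_le ha.2.le]
        exact fun x hx => ⟨ha0.le.trans hx.1, hx.2.trans_lt (hR.2.trans_lt hR₁)⟩
      have hrp : ∀ e : ℝ, ContinuousOn (fun r : ℝ => r ^ e) (uIcc a R) := fun e =>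
        continuousOn_id.rpow_const fun x hx => by
          rw [uIcc_of_le ha.2.le] at hx
          exact Or.inl (ha0.trans_le hx.1).ne'
      have hint : A * |U R| ^ p * ((R ^ Q - a ^ Q) / Q) =
          ∫ r in a..R, A * |U R| ^ p * r ^ (γ + l) := by
        rw [intervalIntegral.integral_const_mul, integral_rpow (Or.inl (by linarith))]
      rw [hint]
      refine intervalIntegral.integral_mono_on ha.2.le ?_ ?_ ?_
      · refine ContinuousOn.intervalIntegrable ?_
        refine ((continuousOn_const.mul (hrp γ)).mul ?_).mul ?_
        · exact (huc.mono hsub).abs.rpow_const fun x _ => Or.inr hl.le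
        · exact (hU.mono hsub).abs.rpow_const fun x _ => Or.inr (by linarith)
      · exact (continuousOn_const.mul (hrp _)).intervalIntegrable
      · intro r hr
        have hr0 : 0 < r := ha0.trans_le hr.1
        have hr1 : r ∈ Icc 0 R₁ := ⟨hr0.le, hr.2.trans hR.2⟩
        have e1 := hM r hr1
        have e2 := hmvt hR₁ hM r hr1
        calc A * r ^ γ * |u r| ^ l * |U r| ^ (p - l)
            ≤ A * r ^ γ * (|U R| * r) ^ l * |U R| ^ (p - l) := by
              have : 0 ≤ p - l := by linarith
              gcongr
          _ = A * (|U R| ^ l * |U R| ^ (p - l)) * (r ^ γ * r ^ l) := by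
              rw [Real.mul_rpow hMpos.le hr0.le]
              ring
          _ = A * |U R| ^ p * r ^ (γ + l) := by
              rw [← Real.rpow_add hMpos, ← Real.rpow_add hr0]
              ring_nf
    -- The energy inequality requires `a > 0`, so `R₀`, possibly `0`, is reached as a limit.
    have hlim : R ^ α * |U R| ^ p ≤
        R₀ ^ α * |U R₀| ^ p + Ψ (u R₀) + A * |U R| ^ p * ((R ^ Q - R₀ ^ Q) / Q) := by
      have hmem : R₀ ∈ Ico (0 : ℝ) 1 := hR₀
      have hsub : Icc R₀ R ⊆ Ico 0 1 := fun x hx =>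
        ⟨hR₀.1.trans hx.1, hx.2.trans_lt (hR.2.trans_lt hR₁)⟩
      have hcl : R₀ ∈ closure (Ioo R₀ R) := by
        rw [closure_Ioo hRR.ne]
        exact ⟨le_rfl, hRR.le⟩
      refine le_of_tendsto_of_tendsto (b := nhdsWithin R₀ (Ioo R₀ R))
        (hb := mem_closure_iff_nhdsWithin_neBot.1 hcl)
        (f := fun _ => R ^ α * |U R| ^ p)
        (g := fun a => a ^ α * |U a| ^ p + Ψ (u a) + A * |U R| ^ p * ((R ^ Q - a ^ Q) / Q))
        tendsto_const_nhds ?_ (Filter.eventually_of_mem self_mem_nhdsWithin hbound)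
      have c1 : ContinuousWithinAt U (Ioo R₀ R) R₀ :=
        (hU R₀ hmem).mono (Ioo_subset_Icc_self.trans hsub)
      have c2 : ContinuousWithinAt u (Ioo R₀ R) R₀ :=
        (huc R₀ hmem).mono (Ioo_subset_Icc_self.trans hsub)
      have c3 : ∀ e : ℝ, 0 ≤ e → ContinuousWithinAt (fun r : ℝ => r ^ e) (Ioo R₀ R) R₀ :=
        fun e he => (Real.continuousAt_rpow_const _ _ (Or.inr he)).continuousWithinAt
      exact (((c3 α hα.le).mul (c1.abs.rpow_const (Or.inr hp.le))).add
        (hΨ.continuousAt.comp_continuousWithinAt c2)).add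
        (continuousWithinAt_const.mul
          ((continuousWithinAt_const.sub (c3 Q (by linarith))).div_const _))
    have hUR₀ : U R₀ = 0 := hz R₀ ⟨hR₀.1, le_rfl⟩
    have huR₀ : u R₀ = 0 := by
      have := hmvt (M := 0) hR₀.2 (fun t ht => by rw [hz t ht, abs_zero]) R₀ ⟨hR₀.1, le_rfl⟩
      rw [zero_mul] at this
      exact abs_eq_zero.1 (le_antisymm this (abs_nonneg _))
    rw [hUR₀, huR₀, hΨ0, abs_zero, Real.zero_rpow hp.ne', mul_zero, zero_add, zero_add] at hlim
    have h4 := h3 R hRR hR.2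
    have h5 : 0 < |U R| ^ p := Real.rpow_pos_of_pos hMpos _
    have h6 : A * |U R| ^ p * ((R ^ Q - R₀ ^ Q) / Q) = A / Q * (R ^ Q - R₀ ^ Q) * |U R| ^ p := by
      ring
    rw [h6] at hlim
    exact absurd (le_of_mul_le_mul_right hlim h5) (not_le.2 h4)
  have hUz : ∀ b ∈ Ico (0 : ℝ) 1, ∀ t ∈ Icc 0 b, U t = 0 := by
    intro b hb
    have hcl : IsClosed ({r | U r = 0} ∩ Icc 0 b) := by
      rw [inter_comm]
      exact (hU.mono (Icc_subset_Ico_right hb.2)).preimage_isClosed_of_isClosed isClosed_Icc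
        (isClosed_singleton (x := (0 : ℝ)))
    -- Continuous induction: the zero set of `U` is closed, and `hstep` extends it to the right.
    refine hcl.Icc_subset_of_forall_mem_nhdsGT_of_Icc_subset hU0 fun t ht hts => ?_
    obtain ⟨R₁, h1, -, h2⟩ := hstep t ⟨ht.1, ht.2.trans hb.2⟩ (fun x hx => hts hx) b ht.2
    exact Filter.mem_of_superset (Ioc_mem_nhdsGT h1)
      fun x hx => h2 x ⟨ht.1.trans hx.1.le, hx.2⟩
  intro r hr
  have := hmvt (M := 0) hr.2 (fun t ht => by rw [hUz r hr t ht, abs_zero]) r ⟨hr.1, le_rfl⟩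
  rw [zero_mul] at this
  exact abs_eq_zero.1 (le_antisymm this (abs_nonneg _))

/-! ### Radial functions and radial test functions -/

theorem hasGradientAt_comp_norm {n : ℕ} {f : ℝ → ℝ} {f' : ℝ} {x : Space n} (hx : x ≠ 0)
    (hf : HasDerivAt f f' ‖x‖) : HasGradientAt (fun y => f ‖y‖) ((f' / ‖x‖) • x) x := by
  have hx' : ‖x‖ ≠ 0 := norm_ne_zero_iff.2 hx
  have h1 : HasFDerivAt (fun y : Space n => ‖y‖) (‖x‖⁻¹ • innerSL ℝ x) x := by
    have := (hasStrictFDerivAt_norm_sq x).hasFDerivAt.sqrt (by positivity)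
    simp only [Real.sqrt_sq (norm_nonneg _)] at this
    refine this.congr_fderiv ?_
    ext y
    simp only [smul_apply, smul_eq_mul, nsmul_eq_mul, Nat.cast_ofNat]
    field_simp
  rw [hasGradientAt_iff_hasFDerivAt]
  have h2 : HasFDerivAt (fun y : Space n => f ‖y‖) _ x := hf.comp_hasFDerivAt x h1
  refine h2.congr_fderiv ?_
  ext y
  simp [div_eq_mul_inv, mul_assoc]

theorem hasGradientAt_of_eqOn_comp_norm {n : ℕ} {w : Space n → ℝ} {u : ℝ → ℝ} {u' : ℝ}
    (hw : ∀ x ∈ unitBall n, w x = u ‖x‖) {x : Space n} (hxB : x ∈ unitBall n) (hx : x ≠ 0)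
    (hu : HasDerivAt u u' ‖x‖) : HasGradientAt w ((u' / ‖x‖) • x) x :=
  (hasGradientAt_comp_norm hx hu).congr_of_eventuallyEq
    (Filter.eventually_of_mem ((unitBall n).isOpen.mem_nhds hxB) hw)

theorem mem_unitBall {n : ℕ} {x : Space n} : x ∈ unitBall n ↔ ‖x‖ < 1 := mem_ball_zero_iff

theorem norm_div_norm_smul {n : ℕ} {x : Space n} (hx : x ≠ 0) (c : ℝ) : ‖(c / ‖x‖) • x‖ = |c| := by
  rw [norm_smul, norm_div, norm_norm, Real.norm_eq_abs, div_mul_cancel₀ _ (norm_ne_zero_iff.2 hx)]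

/-- The profile of a radial `C¹` function. -/
theorem exists_radial_profile {n : ℕ} (hn : 2 ≤ n) {w : Space n → ℝ} (hw : IsRadial w)
    (hC : ContDiffOn ℝ 1 w (unitBall n)) :
    ∃ u U : ℝ → ℝ, (∀ x ∈ unitBall n, w x = u ‖x‖) ∧ (∀ r ∈ Ico (0 : ℝ) 1, HasDerivAt u (U r) r) ∧
      ContinuousOn U (Ico 0 1) ∧ U 0 = 0 := by
  obtain ⟨f, hf⟩ := hw
  -- The profile is `w` along the whole line through `e`; negative `r` provide a two-sided
  -- derivative at `0`.
  let e : Space n := EuclideanSpace.single ⟨0, by omega⟩ 1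
  have he : ‖e‖ = 1 := by simp [e]
  have hmem : ∀ r : ℝ, |r| < 1 → r • e ∈ unitBall n := fun r hr => by
    rw [mem_unitBall, norm_smul, he, mul_one]
    exact hr
  have hval : ∀ r : ℝ, |r| < 1 → w (r • e) = f |r| := fun r hr => by
    rw [hf _ (hmem r hr), norm_smul, he, mul_one, Real.norm_eq_abs]
  have hder : ∀ r : ℝ, |r| < 1 → HasDerivAt (fun r : ℝ => w (r • e)) (fderiv ℝ w (r • e) e) r := by
    intro r hr
    have h1 : HasFDerivAt w (fderiv ℝ w (r • e)) (r • e) :=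
      ((hC.contDiffAt ((unitBall n).isOpen.mem_nhds (hmem r hr))).differentiableAt
        one_ne_zero).hasFDerivAt
    have h2 : HasDerivAt (fun r : ℝ => r • e) e r := by
      simpa using (hasDerivAt_id r).smul_const e
    exact h1.comp_hasDerivAt r h2
  refine ⟨fun r => w (r • e), fun r => fderiv ℝ w (r • e) e, ?_, ?_, ?_, ?_⟩
  · intro x hx
    have hx1 := mem_unitBall.1 hx
    change w x = w (‖x‖ • e)
    rw [hval _ (by rwa [abs_norm]), abs_norm, hf x hx]
  · exact fun r hr => hder r (by rw [abs_of_nonneg hr.1]; exact hr.2)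
  · have h1 : ContinuousOn (fderiv ℝ w) (unitBall n) :=
      hC.continuousOn_fderiv_of_isOpen (unitBall n).isOpen le_rfl
    have h2 : ContinuousOn (fun r : ℝ => fderiv ℝ w (r • e)) (Ico 0 1) :=
      h1.comp (by fun_prop) fun r hr => hmem r (by rw [abs_of_nonneg hr.1]; exact hr.2)
    exact h2.clm_apply continuousOn_const
  · have h0 := hder 0 (by simp)
    -- Along this line `w` is even in `r`, so its derivative at `0` equals its own negative.
    have h1 : HasDerivAt (fun r : ℝ => w (-r • e)) (-(fderiv ℝ w ((0 : ℝ) • e) e)) 0 := by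
      have h2 : HasDerivAt (fun r : ℝ => w (r • e)) (fderiv ℝ w ((0 : ℝ) • e) e) (-0) := by
        rwa [neg_zero]
      have : HasDerivAt (fun r : ℝ => w (-r • e)) _ 0 :=
        HasDerivAt.scomp (g₁ := fun r : ℝ => w (r • e)) (0 : ℝ) h2 (hasDerivAt_neg (0 : ℝ))
      simpa using this
    have h3 : (fun r : ℝ => w (r • e)) =ᶠ[nhds 0] fun r : ℝ => w (-r • e) := by
      filter_upwards [Metric.ball_mem_nhds (0 : ℝ) one_pos] with r hr
      rw [mem_ball_zero_iff, Real.norm_eq_abs] at hr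
      rw [hval r hr, hval (-r) (by rwa [abs_neg]), abs_neg]
    have := h0.unique (h1.congr_of_eventuallyEq h3)
    simp only
    linarith

/-- Radial test functions. -/
theorem exists_testFunction_comp_norm {n : ℕ} {ζ : ℝ → ℝ} (hζ : ContDiff ℝ ∞ ζ)
    (hζc : HasCompactSupport ζ) (hζs : tsupport ζ ⊆ Ioo 0 1) :
    ∃ η : 𝓓(unitBall n, ℝ), ∀ x, η x = ζ ‖x‖ := by
  obtain ⟨a, b, ha, hab, hb, hs⟩ := exists_Ioo_of_isCompact_subset_Ioo one_pos hζc hζs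
  have hz : ∀ r, r ∉ Ioo a b → ζ r = 0 := fun r hr => by
    by_contra h
    exact hr (hs (subset_tsupport ζ h))
  have hts : tsupport (fun x : Space n => ζ ‖x‖) ⊆ Metric.closedBall 0 b := by
    refine closure_minimal (fun x hx => ?_) Metric.isClosed_closedBall
    by_contra h
    rw [mem_closedBall_zero_iff, not_le] at h
    exact hx (hz _ fun h' => (lt_asymm h h'.2))
  refine ⟨⟨fun x => ζ ‖x‖, ?_, ?_, ?_⟩, fun x => rfl⟩
  · refine contDiff_iff_contDiffAt.2 fun x => ?_
    rcases eq_or_ne x 0 with rfl | hx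
    -- `ζ` vanishes near `0`, which hides the singularity of the norm.
    · have : (fun x : Space n => ζ ‖x‖) =ᶠ[nhds 0] fun _ => 0 := by
        filter_upwards [Metric.ball_mem_nhds (0 : Space n) ha] with x hx
        rw [mem_ball_zero_iff] at hx
        exact hz _ fun h => lt_asymm h.1 hx
      exact contDiffAt_const.congr_of_eventuallyEq this
    · exact (hζ.contDiffAt (x := ‖x‖)).comp x (contDiffAt_norm ℝ hx)
  · exact HasCompactSupport.of_support_subset_isCompact (isCompact_closedBall 0 b)
      ((subset_tsupport _).trans hts)
  · exact hts.trans fun x hx => mem_unitBall.2 ((mem_closedBall_zero_iff.1 hx).trans_lt hb)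

theorem continuous_signed_rpow {p : ℝ} (hp : 1 < p) :
    Continuous fun x : ℝ => |x| ^ (p - 2) * x := by
  refine continuous_iff_continuousAt.2 fun x => ?_
  rcases eq_or_ne x 0 with rfl | hx
  · have h1 : ContinuousAt (fun x : ℝ => |x| ^ (p - 1)) 0 :=
      continuous_abs.continuousAt.rpow_const (Or.inr (by linarith))
    rw [ContinuousAt, abs_zero, Real.zero_rpow (by linarith)] at h1
    rw [ContinuousAt, mul_zero]
    refine squeeze_zero_norm (fun x => ?_) h1
    rw [Real.norm_eq_abs, abs_rpow_mul_self hp]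
  · exact (continuous_abs.continuousAt.rpow_const (Or.inl (abs_ne_zero.2 hx))).mul continuousAt_id

/-! ### Reduction of the equation to the profile -/

/-- The null set in `GrowthBound` depends on `(l₀, l₁)`, while a solution needs a single one.
Rational pairs give a countable union, and continuity of `h τ` extends the bound to real pairs. -/
theorem GrowthBound.ae_forall_le {p l γ C : ℝ} {h : ℝ → ℝ → ℝ → ℝ} (hl : 0 < l) (hh : IsCaratheodory h)
    (hg : GrowthBound p l γ C h) :
    ∀ᵐ τ : ℝ, τ ∈ Ioo (0 : ℝ) 1 → ∀ l₀ l₁ : ℝ, 0 < l₁ →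
      |h τ l₀ l₁| ≤ C * τ ^ γ * |l₀| ^ l * l₁ ^ (p - l - 1) := by
  rw [← ae_restrict_iff' measurableSet_Ioo]
  have h1 : ∀ᵐ τ ∂(volume.restrict (Ioo (0 : ℝ) 1)), ∀ a b : ℚ, 0 < b →
      |h τ a b| ≤ C * τ ^ γ * |(a : ℝ)| ^ l * (b : ℝ) ^ (p - l - 1) := by
    rw [ae_all_iff]
    intro a
    rw [ae_all_iff]
    intro b
    by_cases hb : 0 < b
    · filter_upwards [hg a b (by exact_mod_cast hb)] with τ hτ _ using hτ
    · exact Filter.Eventually.of_forall fun τ h' => absurd h' hb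
  filter_upwards [h1, hh.2] with τ h2 h3 l₀ l₁ hl₁
  by_contra! hlt
  have c1 : ContinuousAt (fun z : ℝ × ℝ => |h τ z.1 z.2|) (l₀, l₁) :=
    (h3.continuousAt (prod_mem_nhds Filter.univ_mem (Ici_mem_nhds hl₁))).abs
  have c2 : ContinuousAt
      (fun z : ℝ × ℝ => C * τ ^ γ * |z.1| ^ l * z.2 ^ (p - l - 1)) (l₀, l₁) :=
    (continuousAt_const.mul (continuousAt_fst.abs.rpow_const (Or.inr hl.le))).mul
      (continuousAt_snd.rpow_const (Or.inl hl₁.ne'))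
  have c3 : ∀ᶠ z : ℝ × ℝ in nhds (l₀, l₁), 0 < z.2 :=
    continuousAt_snd.eventually_const_lt hl₁
  obtain ⟨⟨a, b⟩, h4, h5⟩ := ((Rat.denseRange_cast (𝕜 := ℝ)).prodMap
    (Rat.denseRange_cast (𝕜 := ℝ))).mem_nhds ((c2.eventually_lt c1 hlt).and c3)
  simp only [Prod.map] at h4 h5
  exact absurd (h2 a b (by exact_mod_cast h5)) (not_le.2 h4)

/-- The radial form of the equation: `r^{n-1} Φ_p(u')` is the primitive of its weak derivative. -/
theorem radial_equation {n : ℕ} (hn : 2 ≤ n) {p α : ℝ} {h : ℝ → ℝ → ℝ → ℝ}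
    {φ : ℝ → ℝ} (hp : 1 < p) (hα : 0 < α) (hφ : Continuous φ)
    {w : Space n → ℝ} (hw : IsSolution p α h φ w)
    (hC : ContDiffOn ℝ 1 w (unitBall n)) {u U : ℝ → ℝ} (hwu : ∀ x ∈ unitBall n, w x = u ‖x‖)
    (hu : ∀ r ∈ Ico (0 : ℝ) 1, HasDerivAt u (U r) r) (hU : ContinuousOn U (Ico 0 1))
    {κ : ℝ → ℝ} (hκ : κ = fun r => r ^ (n - 1) * ((h r (u r) |U r| - φ (u r)) / r ^ α)) :
    (∀ a ∈ Ioo (0 : ℝ) 1, ∀ b ∈ Ioo (0 : ℝ) 1, IntervalIntegrable κ volume a b) ∧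
    ∀ a ∈ Ioo (0 : ℝ) 1, ∀ b ∈ Ioo (0 : ℝ) 1,
      b ^ (n - 1) * (|U b| ^ (p - 2) * U b) =
        a ^ (n - 1) * (|U a| ^ (p - 2) * U a) + ∫ r in a..b, κ r := by
  obtain ⟨g, ⟨-, hg, hdiv⟩, hh, heq⟩ := hw
  have hn0 : 0 < n := by omega
  have : Nonempty (Fin n) := ⟨⟨0, hn0⟩⟩
  have hdim : Module.finrank ℝ (Space n) = n := finrank_euclideanSpace_fin
  set G : ℝ → ℝ := fun r => (h r (u r) |U r| - φ (u r)) / r ^ α with hG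
  have hgrad : ∀ x ∈ unitBall n, x ≠ 0 → ∇ w x = (U ‖x‖ / ‖x‖) • x := fun x hx hx0 =>
    (hasGradientAt_of_eqOn_comp_norm hwu hx hx0
      (hu _ ⟨norm_nonneg x, mem_unitBall.1 hx⟩)).gradient
  have hlc : IsLocallyClosed (unitBall n : Set (Space n)) := (unitBall n).isOpen.isLocallyClosed
  -- The distributional equation holds a.e., and off the origin it can be divided by `|x|^α`.
  have hgG : ∀ᵐ x : Space n, x ∈ unitBall n → g x = G ‖x‖ := by
    have hφw : ContinuousOn (fun x => φ (w x)) (unitBall n) := hφ.comp_continuousOn hC.continuousOn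
    have hφl : LocallyIntegrableOn (fun x => φ (w x)) (unitBall n) :=
      hφw.locallyIntegrableOn (unitBall n).isOpen.measurableSet
    have hal : LocallyIntegrableOn (fun x => ‖x‖ ^ α * g x) (unitBall n) :=
      hg.continuousOn_mul (continuous_norm.rpow_const fun _ => Or.inr hα.le).continuousOn hlc
    have hL : LocallyIntegrableOn (fun x => -(‖x‖ ^ α * g x) + h ‖x‖ (w x) ‖∇ w x‖)
      (unitBall n) := hal.neg.add hh
    have := (unitBall n).isOpen.ae_eq_zero_of_integral_contDiff_smul_eq_zero (hL.sub hφl) (by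
      intro ψ hψ hψc hψs
      have := heq ⟨ψ, hψ, hψc, hψs⟩
      have e : ∀ x, ψ x • (((fun x => -(‖x‖ ^ α * g x) + h ‖x‖ (w x) ‖∇ w x‖) -
          fun x => φ (w x)) x) = (-(‖x‖ ^ α * g x) + h ‖x‖ (w x) ‖∇ w x‖) * ψ x
          - φ (w x) * ψ x := fun x => by
        simp only [Pi.sub_apply, smul_eq_mul]
        ring
      simp_rw [e]
      have hi : ∀ f : Space n → ℝ, LocallyIntegrableOn f (unitBall n) →
          Integrable (fun x => f x * ψ x) := fun f hf => by
        have h1 : IntegrableOn (fun x => f x * ψ x) (tsupport ψ) :=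
          (hf.integrableOn_compact_subset hψs hψc).mul_continuousOn hψ.continuous.continuousOn hψc
        rwa [integrableOn_iff_integrable_of_support_subset] at h1
        exact fun x hx => subset_tsupport ψ (right_ne_zero_of_mul hx)
      rw [integral_sub (hi _ hL) (hi _ hφl), sub_eq_zero]
      exact this)
    filter_upwards [this, Measure.ae_ne volume (0 : Space n)] with x h1 h2 h3
    have h4 := h1 h3
    have h5 : ‖x‖ ^ α ≠ 0 := (Real.rpow_pos_of_pos (norm_pos_iff.2 h2) _).ne'
    simp only [Pi.sub_apply] at h4
    rw [hgrad x h3 h2, norm_div_norm_smul h2, hwu x h3] at h4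
    simp only [hG]
    rw [eq_div_iff h5]
    linarith
  have hint : ∀ b ∈ Ioo (0 : ℝ) 1, IntegrableOn κ (Ioo 0 b) := by
    intro b hb
    have h1 : IntegrableOn g (Metric.ball (0 : Space n) b) :=
      (hg.integrableOn_compact_subset (t := Metric.closedBall 0 b) (fun x hx => mem_unitBall.2
        ((mem_closedBall_zero_iff.1 hx).trans_lt hb.2)) (isCompact_closedBall 0 b)).mono_set
        Metric.ball_subset_closedBall
    have h2 : IntegrableOn (fun x : Space n => G ‖x‖) (Metric.ball (0 : Space n) b) := by
      refine h1.congr_fun_ae ?_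
      rw [Filter.EventuallyEq, ae_restrict_iff' Metric.isOpen_ball.measurableSet]
      filter_upwards [hgG] with x hx hxb
      exact hx (mem_unitBall.2 ((mem_ball_zero_iff.1 hxb).trans hb.2))
    rw [integrableOn_fun_norm_addHaar, hdim] at h2
    rw [hκ]
    exact h2
  have hκi : ∀ a ∈ Ioo (0 : ℝ) 1, ∀ b ∈ Ioo (0 : ℝ) 1, IntervalIntegrable κ volume a b := by
    intro a ha b hb
    obtain ⟨c, hc, hc1⟩ := exists_between (max_lt ha.2 hb.2)
    rw [intervalIntegrable_iff]
    refine (hint c ⟨(ha.1.trans_le (le_max_left _ _)).trans hc, hc1⟩).mono_set fun x hx => ?_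
    exact ⟨(lt_min ha.1 hb.1).trans hx.1, hx.2.trans_lt hc⟩
  refine ⟨hκi, fun a ha b hb => ?_⟩
  rw [← sub_eq_iff_eq_add']
  refine sub_eq_intervalIntegral_of_weak_deriv (c := 0) (d := 1)
    (V := fun r => r ^ (n - 1) * (|U r| ^ (p - 2) * U r)) ?_ hκi ?_ ha hb
  · exact (continuousOn_id.pow _).mul ((continuous_signed_rpow hp).comp_continuousOn
      (hU.mono Ioo_subset_Ico_self))
  intro ζ hζ hζc hζs
  obtain ⟨η, hη⟩ := exists_testFunction_comp_norm (n := n) hζ hζc hζs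
  have hη' : (η : Space n → ℝ) = fun x => ζ ‖x‖ := funext hη
  have hz : ∀ r, r ∉ Ioo (0 : ℝ) 1 → ζ r = 0 := fun r hr => by
    by_contra h
    exact hr (hζs (subset_tsupport ζ h))
  have hz' : ∀ r, r ∉ Ioo (0 : ℝ) 1 → deriv ζ r = 0 := fun r hr => by
    by_contra h
    exact hr (hζs (support_deriv_subset h))
  -- Polar coordinates produce the same constant `n |B|` on both sides of the weak formulation, and
  -- it cancels.
  have hpolar : ∀ f : ℝ → ℝ, (∀ r, r ∉ Ioo (0 : ℝ) 1 → f r = 0) → ∫ x : Space n, f ‖x‖ =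
      n * (volume : Measure (Space n)).real (Metric.ball 0 1) * ∫ r, r ^ (n - 1) * f r := by
    intro f hf
    rw [integral_fun_norm_addHaar, hdim, setIntegral_eq_integral_of_forall_compl_eq_zero]
    · simp [mul_assoc]
    · intro r hr
      rw [hf r fun h => hr h.1, smul_zero]
  have h1 := hdiv η
  have e1 : ∫ x, inner ℝ (PhiP p (∇ w x)) (∇ (η : Space n → ℝ) x) =
      ∫ x : Space n, (fun r => |U r| ^ (p - 2) * U r * deriv ζ r) ‖x‖ := by
    refine integral_congr_ae ?_
    filter_upwards [Measure.ae_ne volume (0 : Space n)] with x hx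
    have hx' : ‖x‖ ≠ 0 := norm_ne_zero_iff.2 hx
    have h2 : ∇ (η : Space n → ℝ) x = (deriv ζ ‖x‖ / ‖x‖) • x := by
      rw [hη']
      exact (hasGradientAt_comp_norm hx
        (hζ.differentiable (by simp) _).hasDerivAt).gradient
    rw [h2]
    by_cases hxB : x ∈ unitBall n
    · rw [hgrad x hxB hx, PhiP, norm_div_norm_smul hx]
      simp only [real_inner_smul_left, real_inner_smul_right, real_inner_self_eq_norm_sq]
      field_simp
    · rw [hz' ‖x‖ fun h => hxB (mem_unitBall.2 h.2)]
      simp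
  have e2 : ∫ x, g x * η x = ∫ x : Space n, (fun r => G r * ζ r) ‖x‖ := by
    refine integral_congr_ae ?_
    filter_upwards [hgG] with x hx
    rw [hη]
    by_cases hxB : x ∈ unitBall n
    · rw [hx hxB]
    · rw [hz ‖x‖ fun h => hxB (mem_unitBall.2 h.2)]
      simp
  rw [e1, e2, hpolar (fun r => |U r| ^ (p - 2) * U r * deriv ζ r)
      (fun r hr => by rw [hz' r hr, mul_zero]), hpolar (fun r => G r * ζ r) (fun r hr => by rw [hz r hr, mul_zero]), ← mul_neg] at h1
  have hc : (n : ℝ) * (volume : Measure (Space n)).real (Metric.ball 0 1) ≠ 0 := by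
    refine mul_ne_zero (by positivity) (ENNReal.toReal_ne_zero.2
      ⟨(Metric.measure_ball_pos _ _ one_pos).ne', measure_ball_lt_top.ne⟩)
  have h3 := mul_left_cancel₀ hc h1
  rw [hκ]
  simpa only [mul_assoc] using h3

/-! ### Nonexistence -/

theorem not_exists_nontrivial_solution {n : ℕ} {p l α γ : ℝ}
    (hn : 2 ≤ n) (hp : 1 < p) (hl : 0 < l) (hlp : l < p) (hα : 0 < α)
    (hnα : α * (1 - 1 / p) + 1 < (n : ℝ)) (hγ : -1 < γ) (hγα : α - 1 - l < γ)
    {φ : ℝ → ℝ} {C : ℝ} {h : ℝ → ℝ → ℝ → ℝ} (hφ : IsAdmissibleNonlinearity φ) (hC : 0 < C)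
    (hh : IsCaratheodory h) (hg : GrowthBound p l γ C h) {w : Space n → ℝ}
    (hw : IsRegularRadialSolution p α h φ w) : ∀ x ∈ unitBall n, w x = 0 := by
  obtain ⟨u, U, hwu, hu, hU, hU0⟩ := exists_radial_profile hn hw.radial hw.contDiffOn
  obtain ⟨hκi, hV⟩ := radial_equation hn hp hα hφ.continuous hw.solution hw.contDiffOn hwu hu hU rfl
  have huc : ContinuousOn u (Ico 0 1) := fun r hr => (hu r hr).continuousAt.continuousWithinAt
  have hu0 : u 0 = 0 := by
    have := hwu 0 (mem_unitBall.2 (by simp))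
    rwa [hw.zero, norm_zero, eq_comm] at this
  have hp1 : 0 < p - 1 := by linarith
  have hp0 : 0 < p := by linarith
  have hΨ : Continuous fun t => p / (p - 1) * ∫ s in (0)..t, φ s :=
    continuous_const.mul (intervalIntegral.continuous_primitive
      (fun a b => hφ.continuous.intervalIntegrable a b) 0)
  -- The factor `p / (p - 1)` clears the coefficient of the kinetic term in `energy_le`.
  have hz := eq_zero_of_energy_le (A := p / (p - 1) * C) (p := p)
    (Ψ := fun t => p / (p - 1) * ∫ s in (0)..t, φ s) hl hlp hα hγ hγα (by positivity)
    hu hU hu0 hU0 hΨ (by simp) (by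
      intro a b ha hab hb
      have hsub : Icc a b ⊆ Ioo 0 1 := Icc_subset_Ioo ha hb
      have hsub' : Icc a b ⊆ Ico 0 1 := hsub.trans Ioo_subset_Ico_self
      have ha' := hsub ⟨le_rfl, hab.le⟩
      have hb' := hsub ⟨hab.le, le_rfl⟩
      have hE := energy_le (α := α) (k := n - 1) (u := u) (U := U)
        (H := fun r => h r (u r) |U r|)
        (D := fun r => C * r ^ γ * |u r| ^ l * |U r| ^ (p - l)) hp
        (by rw [Nat.cast_sub (by omega), Nat.cast_one]; linarith) ha hab
        hφ.continuous (fun r hr => hu r (hsub' hr)) (hU.mono hsub') (hκi a ha' b hb')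
        (fun x hx => hV a ha' x (hsub hx)) (Filter.Eventually.of_forall fun r _ => rfl) (by
          filter_upwards [GrowthBound.ae_forall_le hl hh hg] with r h1 hr
          have hr0 : 0 < r := (hsub hr).1
          -- Where `U = 0` the product `h U` vanishes, so the bound for `l₁ > 0` is enough.
          rcases eq_or_ne (U r) 0 with h0 | h0
          · rw [h0, mul_zero]
            positivity
          · have h2 := abs_pos.2 h0
            calc h r (u r) |U r| * U r ≤ |h r (u r) (|U r|)| * |U r| := by
                  rw [← abs_mul]
                  exact le_abs_self _
              _ ≤ C * r ^ γ * |u r| ^ l * |U r| ^ (p - l - 1) * |U r| := by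
                  gcongr
                  exact h1 (hsub hr) _ _ h2
              _ = C * r ^ γ * |u r| ^ l * |U r| ^ (p - l) := by
                  rw [mul_assoc _ (|U r| ^ (p - l - 1)), ← Real.rpow_add_one h2.ne']
                  ring_nf) (by
          refine ((continuousOn_const.mul (continuousOn_id.rpow_const fun x hx =>
            Or.inl (hsub hx).1.ne')).mul ?_).mul ?_
          · exact (huc.mono hsub').abs.rpow_const fun x _ => Or.inr hl.le
          · exact (hU.mono hsub').abs.rpow_const fun x _ => Or.inr (by linarith))
      have h3 := hφ.primitive_nonneg (u b)
      have h4 : ∫ r in a..b, p / (p - 1) * C * r ^ γ * |u r| ^ l * |U r| ^ (p - l) =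
          p / (p - 1) * ∫ r in a..b, C * r ^ γ * |u r| ^ l * |U r| ^ (p - l) := by
        rw [← intervalIntegral.integral_const_mul]
        simp only [mul_assoc]
      rw [h4]
      have h5 : p / (p - 1) * ((p - 1) / p) = 1 := by field_simp
      have h6 := mul_le_mul_of_nonneg_left ((le_add_of_nonneg_right h3).trans hE)
        (show 0 ≤ p / (p - 1) by positivity)
      rwa [← mul_assoc, h5, one_mul, mul_add, mul_add, ← mul_assoc, h5, one_mul] at h6)
  intro x hx
  rw [hwu x hx, hz _ ⟨norm_nonneg x, mem_unitBall.1 hx⟩]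

/-! ### Smooth fields: weighted regularity and weak divergence -/

/-- In polar coordinates the density cancels the Jacobian `r^(n-1)`, so balls about `0` have finite
measure. -/
theorem isLocallyFiniteMeasure_weightedVolume {n : ℕ} (hn : 0 < n) :
    IsLocallyFiniteMeasure (weightedVolume n) := by
  have : Nonempty (Fin n) := ⟨⟨0, hn⟩⟩
  have hdim : Module.finrank ℝ (Space n) = n := finrank_euclideanSpace_fin
  refine ⟨fun x => ⟨Metric.ball 0 (‖x‖ + 1),
    Metric.isOpen_ball.mem_nhds (mem_ball_zero_iff.2 (lt_add_one _)), ?_⟩⟩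
  rw [weightedVolume, withDensity_apply _ Metric.isOpen_ball.measurableSet]
  refine Integrable.lintegral_lt_top ?_
  have := (integrableOn_fun_norm_addHaar (volume : Measure (Space n))
    (f := fun r : ℝ => r ^ (-((n : ℝ) - 1))) (r := ‖x‖ + 1)).2
  refine this ?_
  rw [hdim]
  refine (integrableOn_const (s := Ioo 0 (‖x‖ + 1)) (C := (1 : ℝ)) (by simp)).congr_fun
    (fun r hr => ?_) measurableSet_Ioo
  have h1 : ((n : ℝ) - 1) = ((n - 1 : ℕ) : ℝ) := by
    rw [Nat.cast_sub hn, Nat.cast_one]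
  have h2 : r ^ (n - 1) ≠ 0 := pow_ne_zero _ hr.1.ne'
  rw [Real.rpow_neg hr.1.le, h1, Real.rpow_natCast, smul_eq_mul, mul_inv_cancel₀ h2]

theorem integral_fderiv_testFunction_smul {n : ℕ} {E : Type*} [NormedAddCommGroup E]
    [NormedSpace ℝ E] {F : Space n → E} (hF : ContDiff ℝ 1 F) (η : 𝓓(unitBall n, ℝ))
    (v : Space n) : ∫ x, (fderiv ℝ η x v) • F x = - ∫ x, η x • fderiv ℝ F x v := by
  have hη1 : ContDiff ℝ 1 η := η.contDiff.of_le (by simp)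
  have hdF : Continuous fun x => fderiv ℝ F x v :=
    (hF.continuous_fderiv one_ne_zero).clm_apply continuous_const
  have hdη : Continuous fun x => fderiv ℝ η x v :=
    (hη1.continuous_fderiv one_ne_zero).clm_apply continuous_const
  have hcη : HasCompactSupport fun x => fderiv ℝ η x v :=
    η.hasCompactSupport.fderiv_apply (𝕜 := ℝ) v
  rw [integral_smul_fderiv_eq_neg_fderiv_smul_of_integrable, neg_neg]
  · exact (hdη.smul hF.continuous).integrable_of_hasCompactSupport hcη.smul_right
  · exact (η.continuous.smul hdF).integrable_of_hasCompactSupport η.hasCompactSupport.smul_right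
  · exact (η.continuous.smul hF.continuous).integrable_of_hasCompactSupport
      η.hasCompactSupport.smul_right
  · exact fun x _ => hη1.differentiable one_ne_zero x
  · exact fun x _ => hF.differentiable one_ne_zero x

theorem memWeightedW11Loc_of_contDiff {n : ℕ} (hn : 0 < n) {F : Space n → Space n}
    (hF : ContDiff ℝ 1 F) : MemWeightedW11Loc F := by
  have := isLocallyFiniteMeasure_weightedVolume hn
  have hd := hF.continuous_fderiv one_ne_zero
  exact ⟨fderiv ℝ F, ⟨hF.continuous.locallyIntegrable.locallyIntegrableOn _,
    hd.locallyIntegrable.locallyIntegrableOn _, integral_fderiv_testFunction_smul hF⟩,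
    hF.continuous.locallyIntegrable.locallyIntegrableOn _,
    hd.locallyIntegrable.locallyIntegrableOn _⟩

theorem isWeakDiv_of_contDiff {n : ℕ} {F : Space n → Space n} (hF : ContDiff ℝ 1 F) :
    IsWeakDiv F fun x => ∑ i, fderiv ℝ F x (EuclideanSpace.single i 1) i := by
  have hd : ∀ i, Continuous fun x => fderiv ℝ F x (EuclideanSpace.single i 1) i := fun i =>
    (PiLp.continuous_apply 2 _ i).comp
      ((hF.continuous_fderiv one_ne_zero).clm_apply continuous_const)
  refine ⟨hF.continuous.locallyIntegrable.locallyIntegrableOn _,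
    (continuous_finsetSum _ fun i _ => hd i).locallyIntegrable.locallyIntegrableOn _,
    fun η => ?_⟩
  have hη1 : ContDiff ℝ 1 η := η.contDiff.of_le (by simp)
  have hFi : ∀ i, ContDiff ℝ 1 fun x => F x i := fun i =>
    (EuclideanSpace.proj (𝕜 := ℝ) i).contDiff.comp hF
  have e1 : ∀ x, inner ℝ (F x) (∇ (η : Space n → ℝ) x) =
      ∑ i, fderiv ℝ η x (EuclideanSpace.single i 1) • F x i := fun x => by
    rw [PiLp.inner_apply]
    refine Finset.sum_congr rfl fun i _ => ?_
    rw [← inner_gradient_left, EuclideanSpace.inner_single_right]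
    simp
  have e2 : ∀ x, (∑ i, fderiv ℝ F x (EuclideanSpace.single i 1) i) * η x =
      ∑ i, η x • fderiv ℝ (fun x => F x i) x (EuclideanSpace.single i 1) := fun x => by
    rw [Finset.sum_mul]
    refine Finset.sum_congr rfl fun i _ => ?_
    have h1 : HasFDerivAt (fun x => F x i)
        ((EuclideanSpace.proj (𝕜 := ℝ) i).comp (fderiv ℝ F x)) x :=
      (EuclideanSpace.proj (𝕜 := ℝ) i).hasFDerivAt.comp x
        (hF.differentiable one_ne_zero x).hasFDerivAt
    rw [h1.fderiv, smul_eq_mul, mul_comm]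
    rfl
  simp_rw [e1, e2]
  rw [integral_finsetSum, integral_finsetSum, ← Finset.sum_neg_distrib]
  · exact Finset.sum_congr rfl fun i _ => integral_fderiv_testFunction_smul (hFi i) η _
  · exact fun i _ => (η.continuous.smul (((hFi i).continuous_fderiv one_ne_zero).clm_apply
      continuous_const)).integrable_of_hasCompactSupport η.hasCompactSupport.smul_right
  · exact fun i _ => (((hη1.continuous_fderiv one_ne_zero).clm_apply continuous_const).smul
      (hFi i).continuous).integrable_of_hasCompactSupport
        (η.hasCompactSupport.fderiv_apply (𝕜 := ℝ) _).smul_right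

theorem isWeakDiv_norm_sq_smul {n : ℕ} (c : ℝ) :
    IsWeakDiv (fun x : Space n => (c * ‖x‖ ^ 2) • x) fun x => c * (n + 2) * ‖x‖ ^ 2 := by
  have hF : ContDiff ℝ 1 fun x : Space n => (c * ‖x‖ ^ 2) • x :=
    (contDiff_const.mul (contDiff_norm_sq ℝ)).smul contDiff_id
  convert isWeakDiv_of_contDiff hF using 1
  ext x
  have h1 : HasFDerivAt (fun x : Space n => (c * ‖x‖ ^ 2) • x) _ x :=
    (((hasStrictFDerivAt_norm_sq x).hasFDerivAt.const_mul c)).smul (hasFDerivAt_id x)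
  rw [h1.fderiv]
  have h3 : ‖x‖ ^ 2 = ∑ i, x i ^ 2 := by simp [EuclideanSpace.norm_sq_eq]
  have h4 : ∀ i : Fin n, ((c * ‖x‖ ^ 2) • ContinuousLinearMap.id ℝ (Space n) +
      (c • 2 • innerSL ℝ x).smulRight x) (EuclideanSpace.single i 1) i =
      c * ‖x‖ ^ 2 + 2 * c * x i ^ 2 := fun i => by
    simp [EuclideanSpace.inner_single_right]
    ring
  refine Eq.trans ?_ (Finset.sum_congr rfl fun i _ => (h4 i).symm)
  rw [Finset.sum_add_distrib, ← Finset.mul_sum Finset.univ (fun i => x i ^ 2), ← h3]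
  simp
  ring

/-! ### Sharpness: the solution `|x|^s` -/

/-- The lower order term for which `|x|^s` solves the equation. -/
noncomputable def sharpTerm (p l e s K : ℝ) (τ l₀ l₁ : ℝ) : ℝ :=
  K * τ ^ e * |l₀| ^ l * (if p - l - 1 < 0 then max l₁ (s * τ ^ (s - 1)) else l₁) ^ (p - l - 1)

/-- For `p - l - 1 < 0` the power of `l₁` is singular at `0`; the maximum keeps its base at least `s
τ^(s-1) > 0`. -/
theorem isCaratheodory_sharpTerm {p l e s K : ℝ} (hl : 0 < l) (hs : 0 < s) :
    IsCaratheodory (sharpTerm p l e s K) := by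
  unfold sharpTerm
  constructor
  · intro l₀ l₁ _
    refine Measurable.aestronglyMeasurable ?_
    split_ifs <;> fun_prop
  · rw [ae_restrict_iff' measurableSet_Ioo]
    refine Filter.Eventually.of_forall fun τ hτ => ?_
    refine ContinuousOn.mul ?_ ?_
    · exact (continuous_const.mul
        (continuous_fst.abs.rpow_const fun _ => Or.inr hl.le)).continuousOn
    · split_ifs with h
      · refine (continuous_snd.max continuous_const).continuousOn.rpow_const fun z _ => Or.inl ?_
        exact ((mul_pos hs (Real.rpow_pos_of_pos hτ.1 _)).trans_le (le_max_right _ _)).ne'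
      · exact continuousOn_snd.rpow_const fun z _ => Or.inr (not_lt.1 h)

/-- Raising the base lowers a negative power, and `τ^e ≤ τ^γ` because `τ < 1`. -/
theorem growthBound_sharpTerm {p l γ e s K : ℝ} (hK : 0 < K) (hγ : γ ≤ e) :
    GrowthBound p l γ K (sharpTerm p l e s K) := by
  intro l₀ l₁ hl₁
  rw [ae_restrict_iff' measurableSet_Ioo]
  refine Filter.Eventually.of_forall fun τ hτ => ?_
  have h1 : 0 ≤ (if p - l - 1 < 0 then max l₁ (s * τ ^ (s - 1)) else l₁) ^ (p - l - 1) := by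
    split_ifs
    · exact Real.rpow_nonneg (hl₁.le.trans (le_max_left _ _)) _
    · exact Real.rpow_nonneg hl₁.le _
  have h2 : (if p - l - 1 < 0 then max l₁ (s * τ ^ (s - 1)) else l₁) ^ (p - l - 1) ≤
      l₁ ^ (p - l - 1) := by
    split_ifs with h
    · exact Real.rpow_le_rpow_of_nonpos hl₁ (le_max_left _ _) h.le
    · exact le_rfl
  have h3 : 0 ≤ τ ^ e := Real.rpow_nonneg hτ.1.le _
  have h4 : τ ^ e ≤ τ ^ γ := Real.rpow_le_rpow_of_exponent_ge hτ.1 hτ.2.le hγ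
  have h5 : 0 ≤ τ ^ γ := h3.trans h4
  rw [sharpTerm, abs_of_nonneg (by positivity)]
  gcongr

/-- For `w = |x|^s` the gradient norm is exactly the truncation level, so the maximum has no effect.
-/
theorem sharpTerm_apply {p l e s K τ : ℝ} (hs : 0 < s) (hτ : 0 < τ) :
    sharpTerm p l e s K τ (τ ^ s) (s * τ ^ (s - 1)) =
      K * s ^ (p - l - 1) * τ ^ (e + l + (s - 1) * (p - 1)) := by
  have h1 : 0 < τ ^ (s - 1) := Real.rpow_pos_of_pos hτ _
  rw [sharpTerm, max_self, ite_self, abs_of_nonneg (by positivity), Real.mul_rpow hs.le h1.le,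
    ← Real.rpow_mul hτ.le, ← Real.rpow_mul hτ.le]
  have : e + l + (s - 1) * (p - 1) = e + s * l + (s - 1) * (p - l - 1) := by ring
  rw [this, Real.rpow_add hτ, Real.rpow_add hτ]
  ring

theorem isAdmissibleNonlinearity_signed_rpow {p : ℝ} (hp : 1 < p) :
    IsAdmissibleNonlinearity fun t => |t| ^ (p - 2) * t where
  continuous := continuous_signed_rpow hp
  odd t := by rw [abs_neg, mul_neg]
  pos := by
    filter_upwards [Measure.ae_ne volume (0 : ℝ)] with t ht
    have := abs_pos.2 ht
    have h2 : 0 < t * t := mul_self_pos.2 ht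
    have h3 : t * (|t| ^ (p - 2) * t) = |t| ^ (p - 2) * (t * t) := by ring
    rw [h3]
    positivity

theorem gradient_norm_rpow {n : ℕ} {s : ℝ} (hs : 1 < s) (x : Space n) :
    ∇ (fun x : Space n => ‖x‖ ^ s) x = (s * ‖x‖ ^ (s - 2)) • x := by
  refine HasGradientAt.gradient ?_
  rw [hasGradientAt_iff_hasFDerivAt]
  refine (hasFDerivAt_norm_rpow x hs).congr_fderiv ?_
  ext y
  simp

theorem norm_gradient_norm_rpow {n : ℕ} {s : ℝ} (hs : 1 < s) {x : Space n} (hx : x ≠ 0) :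
    ‖∇ (fun x : Space n => ‖x‖ ^ s) x‖ = s * ‖x‖ ^ (s - 1) := by
  have hx' : 0 < ‖x‖ := norm_pos_iff.2 hx
  rw [gradient_norm_rpow hs, norm_smul, Real.norm_eq_abs, abs_of_nonneg (by positivity), mul_assoc,
    ← Real.rpow_add_one hx'.ne']
  ring_nf

/-- The length is `s^(p-1) |x|^((s-1)(p-1))`; the value `3` yields a polynomial field whatever `p`
is. -/
theorem phiP_gradient_norm_rpow {n : ℕ} {p s : ℝ} (hs : 1 < s) (hsp : (s - 1) * (p - 1) = 3)
    (x : Space n) :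
    PhiP p (∇ (fun x : Space n => ‖x‖ ^ s) x) = (s ^ (p - 1) * ‖x‖ ^ 2) • x := by
  rcases eq_or_ne x 0 with rfl | hx
  · rw [gradient_norm_rpow hs, PhiP, smul_zero, smul_zero, smul_zero]
  · have hx' : 0 < ‖x‖ := norm_pos_iff.2 hx
    have hs0 : 0 < s := by linarith
    rw [PhiP, norm_gradient_norm_rpow hs hx, gradient_norm_rpow hs, smul_smul,
      Real.mul_rpow hs0.le (by positivity), ← Real.rpow_mul hx'.le]
    congr 1
    have e1 : s ^ (p - 1) = s ^ (p - 2) * s := by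
      rw [← Real.rpow_add_one hs0.ne']
      ring_nf
    have e2 : ‖x‖ ^ 2 = ‖x‖ ^ ((s - 1) * (p - 2)) * ‖x‖ ^ (s - 2) := by
      rw [← Real.rpow_add hx', ← Real.rpow_natCast]
      congr 1
      push_cast
      linarith
    rw [e1, e2]
    ring

theorem exists_nontrivial_solution {n : ℕ} {p l α γ : ℝ} (hn : 0 < n) (hp : 1 < p) (hl : 0 < l)
    (hα : 0 < α) (hγα : γ ≤ α - 1 - l) :
    ∃ (φ : ℝ → ℝ) (C : ℝ) (h : ℝ → ℝ → ℝ → ℝ),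
      IsAdmissibleNonlinearity φ ∧ 0 < C ∧ IsCaratheodory h ∧ GrowthBound p l γ C h ∧
      ∃ (w : Space n → ℝ) (s : ℝ), 1 < s ∧ (∀ x, w x = ‖x‖ ^ s) ∧
        IsRegularRadialSolution p α h φ w ∧ ∃ x ∈ unitBall n, w x ≠ 0 := by
  have hp1 : 0 < p - 1 := by linarith
  obtain ⟨s, hs, hsp⟩ : ∃ s : ℝ, 1 < s ∧ (s - 1) * (p - 1) = 3 :=
    ⟨1 + 3 / (p - 1), by linarith [div_pos three_pos hp1], by field_simp; ring⟩
  have hs0 : 0 < s := by linarith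
  set c := s ^ (p - 1) with hc
  have hc0 : 0 < c := Real.rpow_pos_of_pos hs0 _
  -- Chosen so that `w^m = |x|^(α+2)`.
  set m := (α + 2) / s with hm
  have hm0 : 0 < m := by positivity
  have hsm : s * m = α + 2 := by
    rw [hm]
    field_simp
  -- `|x|^α Δ_p w` has coefficient `c (n + 2)`; the extra `1` is what `φ(w)` must balance.
  set K := (c * (n + 2) + 1) / s ^ (p - l - 1) with hK
  have hsK : 0 < s ^ (p - l - 1) := Real.rpow_pos_of_pos hs0 _
  have hK0 : 0 < K := by positivity
  have hF : (fun x => PhiP p (∇ (fun x : Space n => ‖x‖ ^ s) x)) = fun x => (c * ‖x‖ ^ 2) • x :=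
    funext fun x => phiP_gradient_norm_rpow hs hsp x
  have hh : ∀ x : Space n, x ≠ 0 → sharpTerm p l (α - 1 - l) s K ‖x‖ (‖x‖ ^ s)
      ‖∇ (fun x : Space n => ‖x‖ ^ s) x‖ = (c * (n + 2) + 1) * ‖x‖ ^ (α + 2) := fun x hx => by
    have e1 : α - 1 - l + l + (s - 1) * (p - 1) = α + 2 := by linarith
    rw [norm_gradient_norm_rpow hs hx, sharpTerm_apply hs0 (norm_pos_iff.2 hx), e1, hK,
      div_mul_cancel₀ _ hsK.ne']
  -- `φ(t) = |t|^(m-1) t`, the signed power with `m + 1 > 1` in place of `p`.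
  refine ⟨fun t => |t| ^ (m + 1 - 2) * t, K, sharpTerm p l (α - 1 - l) s K,
    isAdmissibleNonlinearity_signed_rpow (by linarith), hK0, isCaratheodory_sharpTerm hl hs0,
    growthBound_sharpTerm hK0 hγα, fun x => ‖x‖ ^ s, s, hs, fun x => rfl, ?_, ?_⟩
  · refine ⟨⟨fun r => r ^ s, fun x _ => rfl⟩, (contDiff_norm_rpow hs).contDiffOn, ?_, ?_, ?_⟩
    · simp [hs0.ne']
    · rw [hF]
      exact memWeightedW11Loc_of_contDiff hn
        ((contDiff_const.mul (contDiff_norm_sq ℝ)).smul contDiff_id)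
    · refine ⟨fun x => c * (n + 2) * ‖x‖ ^ 2, hF ▸ isWeakDiv_norm_sq_smul c, ?_, fun η => ?_⟩
      · have h1 : Continuous fun x : Space n => (c * (n + 2) + 1) * ‖x‖ ^ (α + 2) :=
          continuous_const.mul (continuous_norm.rpow_const fun _ => Or.inr (by linarith))
        refine (h1.locallyIntegrable.locallyIntegrableOn _).congr (ae_restrict_of_ae ?_)
        have : Nonempty (Fin n) := ⟨⟨0, hn⟩⟩
        filter_upwards [Measure.ae_ne volume (0 : Space n)] with x hx
        exact (hh x hx).symm
      · refine integral_congr_ae ?_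
        have : Nonempty (Fin n) := ⟨⟨0, hn⟩⟩
        filter_upwards [Measure.ae_ne volume (0 : Space n)] with x hx
        have hx' : 0 < ‖x‖ := norm_pos_iff.2 hx
        have e1 : ‖x‖ ^ (α + 2) = ‖x‖ ^ α * ‖x‖ ^ 2 := by
          rw [Real.rpow_add hx', Real.rpow_two]
        have e2 : |(‖x‖ ^ s)| ^ (m + 1 - 2) * ‖x‖ ^ s = ‖x‖ ^ (α + 2) := by
          rw [abs_of_nonneg (by positivity), ← Real.rpow_mul hx'.le, ← Real.rpow_add hx', ← hsm]
          ring_nf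
        rw [hh x hx, e2, e1]
        ring
  · have hx : ‖(EuclideanSpace.single ⟨0, hn⟩ (1 / 2) : Space n)‖ = 1 / 2 := by simp
    refine ⟨EuclideanSpace.single ⟨0, hn⟩ (1 / 2), mem_unitBall.2 ?_, ?_⟩
    · rw [hx]
      norm_num
    · change ‖(EuclideanSpace.single ⟨0, hn⟩ (1 / 2) : Space n)‖ ^ s ≠ 0
      rw [hx]
      positivity

end RadialPLaplace


theorem mainTheorem5 (n : ℕ) (p l α γ : ℝ)
    (hn : 2 ≤ n) (hp : 1 < p) (hl : 0 < l) (hlp : l < p) (hα : 0 < α) (hαp : α < p)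
    (hnα : α * (1 - 1 / p) + 1 < (n : ℝ)) (hγ : -1 < γ) :
    (α - 1 - l < γ →
      ∀ (φ : ℝ → ℝ) (C : ℝ) (h : ℝ → ℝ → ℝ → ℝ),
        RadialPLaplace.IsAdmissibleNonlinearity φ → 0 < C →
        RadialPLaplace.IsCaratheodory h → RadialPLaplace.GrowthBound p l γ C h →
        ¬ ∃ w : RadialPLaplace.Space n → ℝ,
          RadialPLaplace.IsRegularRadialSolution p α h φ w ∧
          ∃ x ∈ RadialPLaplace.unitBall n, w x ≠ 0) ∧
    (γ ≤ α - 1 - l →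
      ∃ (φ : ℝ → ℝ) (C : ℝ) (h : ℝ → ℝ → ℝ → ℝ),
        RadialPLaplace.IsAdmissibleNonlinearity φ ∧ 0 < C ∧
        RadialPLaplace.IsCaratheodory h ∧ RadialPLaplace.GrowthBound p l γ C h ∧
        ∃ (w : RadialPLaplace.Space n → ℝ) (s : ℝ),
          1 < s ∧ (∀ x, w x = ‖x‖ ^ s) ∧
          RadialPLaplace.IsRegularRadialSolution p α h φ w ∧
          ∃ x ∈ RadialPLaplace.unitBall n, w x ≠ 0) :=
  ⟨fun hγα _ _ _ hφ hC hh hg ⟨_, hw, x, hx, hne⟩ =>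
      hne (RadialPLaplace.not_exists_nontrivial_solution hn hp hl hlp hα hnα hγ hγα hφ hC hh hg
        hw x hx),
    fun hγα => RadialPLaplace.exists_nontrivial_solution (by omega) hp hl hα hγα⟩
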